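/- For a finite simple graph $G$ and $p\in[0,1]$ let $G_p$ denote the random subgraph of $G$ obtained by deleting every edge independently with probability $1-p$. Let $\mathcal G$ be the set of all sequences $(G_k)_{k\ge 1}$ of finite simple graphs such that $G_k$ has minimum degree at least $k$. For a real $c>0$ consider $p=c/k$ (defined for all $k\ge c$), let "a.a.s." mean "with probability tending to $1$ as $k\to\infty$", and define $$\beta'(c)=\inf_{(G_k)_{k\ge1}\in\mathcal G}\ \sup\{\alpha\ge 0:\ (G_k)_{c/k}\text{ contains a cycle of length at least }\alpha k\text{ a.a.s.}\}\in[0,\infty],$$ where $\sup\emptyset=0$. **Theorem.** As $c\to\infty$ we have $$\beta'(c)=1-O\left(c^{-1/5}\right);$$ in particular $\beta'(c)<\infty$ for all sufficiently large $c$. Equivalently to the lower bound on $\beta'(c)$ contained in this: there are constants $C,c_0>0$ such that for every $c\ge c_0$ and every sequence $(G_k)_{k\ge1}\in\mathcal G$, a.a.s. $(G_k)_{c/k}$ contains a cycle of length at least $\left(1-C\,c^{-1/5}\right)k$. -/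

import Mathlib

open Filter Topology MeasureTheory
open scoped NNReal ENNReal

universe u

noncomputable section

/-- The law of the random subgraph `G_p` of `G`: every edge of `G` is kept with probability `p`
and deleted with probability `1 - p`, mutually independently. -/
def randomSubgraph {V : Type u} (G : SimpleGraph V) (p : unitInterval) :
    Measure (SimpleGraph V) :=
  (ProbabilityTheory.setBernoulli G.edgeSet p).map SimpleGraph.fromEdgeSet

/-- The real number `x` as a probability; this is `x` itself whenever `0 ≤ x ≤ 1`. -/
def toProb (x : ℝ) : unitInterval := Set.projIcc 0 1 zero_le_one x

/-- `H` contains a cycle of length at least `ℓ`. -/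
def HasCycleOfLengthAtLeast {V : Type u} (H : SimpleGraph V) (ℓ : ℝ) : Prop :=
  ∃ (v : V) (w : H.Walk v v), w.IsCycle ∧ ℓ ≤ (w.length : ℝ)

open Classical in
/-- A sequence of finite simple graphs `G_1, G_2, …` such that `G_k` has minimum degree at
least `k`. (The graph with index `0` is unconstrained and plays no role; for `k ≥ 1` the graph
`G_k` is automatically nonempty, since the minimum degree of the empty graph is `0`.) -/
structure MinDegreeSequence where
  /-- The vertex set of `G_k`. -/
  V : ℕ → Type u
  [fintypeV : ∀ k, Fintype (V k)]
  /-- The graph `G_k`. -/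
  G : ∀ k, SimpleGraph (V k)
  le_minDegree : ∀ k, 1 ≤ k → k ≤ (G k).minDegree

/-- Asymptotically almost surely as `k → ∞`, the random graph `(G_k)_p` with `p = c / k` contains
a cycle of length at least `α k`. -/
def AASHasCycle (S : MinDegreeSequence.{u}) (c α : ℝ) : Prop :=
  Tendsto
    (fun k : ℕ => randomSubgraph (S.G k) (toProb (c / k))
      {H | HasCycleOfLengthAtLeast H (α * k)})
    atTop (𝓝 1)

/-- `β'(c)`: the infimum over all graph sequences of the supremum of the `α ≥ 0` such that a.a.s.
`(G_k)_{c/k}` contains a cycle of length at least `α k`. The supremum may be infinite for some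
sequences, hence the values in `[0, ∞]`. -/
def betaPrime (c : ℝ) : ℝ≥0∞ :=
  ⨅ S : MinDegreeSequence.{u}, ⨆ α : ℝ≥0, ⨆ _ : AASHasCycle S c α, (α : ℝ≥0∞)

end

/-!
Let `ε = c ^ (-1/5)` and `p = c / k`. It suffices to find a.a.s. a cycle of length at least
`(1 - 5 ε) k` in the random subgraph of a graph `G` with minimum degree at least `k` on `n` vertices
(`aasHasCycle_of_log_le`); complete graphs show `β'(c) ≤ 1` (`betaPrime_le_one`). Passing to a
subgraph, `G` has average degree at most `2 k` (`exists_sparse_subgraph`). The random subgraph is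
exposed in two rounds of edge probability about `p / 2` each (`map_union_setBernoulli`).

*First round.* Every graph has a normal spanning forest, that is, a rooted forest such that all edges
of the graph join a vertex to one of its ancestors (`exists_normal_forest`). Take such a forest `F`
for the graph of the first round. The edges of `G` between vertices that are incomparable in `F`
("crossing" edges) are all absent from the first round. A rooted forest in `G` is a choice of at most
one parent for each vertex, so the expected number of forests in the first round is at most
`(1 + c) ^ n`, and a union bound over forests shows that a.a.s. the number of crossing edges is at
most a small multiple of `ε ^ 4 k n` (`setBernoulli_real_badForestEvent_le`). This is where the
condition that `c ε ^ 4` is large compared to `log c` comes from.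

*Structure of the forest.* Call an edge of `G` long if it joins comparable vertices at distance more
than `ℓ ≈ (1 - 5 ε) k` in `F`. If there are order `k ^ 2` long edges, one of them is a.a.s. present in
the second round and closes a cycle with `F`. Otherwise almost every vertex has about `k` short
edges, and these go to ancestors or descendants at distance at most `ℓ`. Double counting of ancestors
and descendants shows that almost every vertex has not many more than `ℓ` descendants on the next
`ℓ` levels (`IsRootedForest.card_bad_le`), hence sends at least about `ε k` edges up to ancestors at
distance at least `ε k`. Another double counting gives a path of length at least `5 k` in `F` almost
all of whose vertices have this property (`IsRootedForest.exists_path_with_chords`).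

*Second round.* Each short window of this path is the start of order `k ^ 2` chords, so a.a.s. for
each window one of them is present in the second round. A chain of overlapping chords closes a cycle
through more than half of the path (`exists_cycle_of_chords`), which is longer than `k`.
-/

/-! ### Rooted forests given by parent functions -/

/-- `f` is the parent function of a rooted forest on `V` with depth function `d`. Roots are the
fixed points of `f`, and have depth `0`. -/
structure IsRootedForest {V : Type u} (f : V → V) (d : V → ℕ) : Prop where
  root : ∀ v, f v = v → d v = 0
  succ : ∀ v, f v ≠ v → d v = d (f v) + 1

/-- `a` is an ancestor of `x` (possibly `x` itself) for the parent function `f`. -/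
def IsAncestor {V : Type u} (f : V → V) (a x : V) : Prop := ∃ j : ℕ, f^[j] x = a

lemma IsAncestor.refl {V : Type u} (f : V → V) (x : V) : IsAncestor f x x := ⟨0, rfl⟩

lemma IsAncestor.trans {V : Type u} {f : V → V} {a b x : V} (h₁ : IsAncestor f a b)
    (h₂ : IsAncestor f b x) : IsAncestor f a x := by
  obtain ⟨i, rfl⟩ := h₂
  obtain ⟨j, rfl⟩ := h₁
  exact ⟨j + i, Function.iterate_add_apply f j i x⟩

lemma isAncestor_iterate {V : Type u} (f : V → V) (j : ℕ) (x : V) : IsAncestor f (f^[j] x) x :=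
  ⟨j, rfl⟩

lemma isAncestor_iff_of_ne {V : Type u} {f : V → V} {a x : V} (h : x ≠ a) :
    IsAncestor f a x ↔ IsAncestor f a (f x) := by
  constructor
  · rintro ⟨j, hj⟩
    cases j with
    | zero => exact absurd hj h
    | succ j => exact ⟨j, by simpa using hj⟩
  · rintro ⟨j, hj⟩
    exact ⟨j + 1, by simpa using hj⟩

namespace IsRootedForest

variable {V : Type u} {f : V → V} {d : V → ℕ}

lemma depth_parent (h : IsRootedForest f d) {v : V} (hv : d v ≠ 0) :
    f v ≠ v ∧ d v = d (f v) + 1 := by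
  have h1 : f v ≠ v := fun h' => hv (h.root v h')
  exact ⟨h1, h.succ v h1⟩

lemma depth_iterate (h : IsRootedForest f d) (u : V) (j : ℕ) (hj : j ≤ d u) :
    d (f^[j] u) + j = d u := by
  induction j with
  | zero => simp
  | succ j ih =>
    have h1 := ih (by omega)
    have h2 := h.depth_parent (v := f^[j] u) (by omega)
    rw [Function.iterate_succ_apply']
    omega

lemma iterate_fixed (h : IsRootedForest f d) (u : V) (j : ℕ) : f^[d u + j] u = f^[d u] u := by
  have h0 : d (f^[d u] u) = 0 := by
    have := h.depth_iterate u (d u) le_rfl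
    omega
  have h1 : f (f^[d u] u) = f^[d u] u := by
    by_contra h'
    have := h.succ _ h'
    omega
  rw [add_comm, Function.iterate_add_apply]
  exact Function.iterate_fixed h1 j

lemma exists_le_depth (h : IsRootedForest f d) {a x : V} (hax : IsAncestor f a x) :
    ∃ j ≤ d x, f^[j] x = a := by
  obtain ⟨j, rfl⟩ := hax
  rcases le_total j (d x) with hj | hj
  · exact ⟨j, hj, rfl⟩
  · obtain ⟨i, rfl⟩ := Nat.exists_eq_add_of_le hj
    exact ⟨d x, le_rfl, (h.iterate_fixed x i).symm⟩

lemma depth_le (h : IsRootedForest f d) {a x : V} (hax : IsAncestor f a x) : d a ≤ d x := by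
  obtain ⟨j, hj, rfl⟩ := h.exists_le_depth hax
  have := h.depth_iterate x j hj
  omega

lemma iterate_sub_depth (h : IsRootedForest f d) {a x : V} (hax : IsAncestor f a x) :
    f^[d x - d a] x = a := by
  obtain ⟨j, hj, rfl⟩ := h.exists_le_depth hax
  have := h.depth_iterate x j hj
  congr 2
  omega

lemma eq_of_isAncestor_of_depth_eq (h : IsRootedForest f d) {a x : V} (hax : IsAncestor f a x)
    (hd : d a = d x) : a = x := by
  have := h.iterate_sub_depth hax
  simpa [hd] using this.symm

lemma iterate_injOn (h : IsRootedForest f d) (u : V) {i j : ℕ} (hi : i ≤ d u) (hj : j ≤ d u)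
    (hij : f^[i] u = f^[j] u) : i = j := by
  have h1 := h.depth_iterate u i hi
  have h2 := h.depth_iterate u j hj
  rw [hij] at h1
  omega

/-- The depth function is determined by the parent function. -/
lemma depth_unique {d' : V → ℕ} (h : IsRootedForest f d) (h' : IsRootedForest f d') : d = d' := by
  funext v
  induction hn : d v using Nat.strong_induction_on generalizing v with
  | _ n ih =>
    by_cases hv : f v = v
    · rw [h'.root v hv, ← hn, h.root v hv]
    · have h1 := h.succ v hv
      rw [h'.succ v hv, ← ih (d (f v)) (by omega) (f v) rfl, ← hn, h1]

/-- Re-hanging the subtree of `u` below a vertex `v` outside of it gives a rooted forest again. If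
`v` is at least as deep as `u`, all depths in that subtree go up. -/
lemma rehang [DecidableEq V] (h : IsRootedForest f d) {u v : V} (hvu : ¬ IsAncestor f u v)
    (hd : d u ≤ d v) : ∃ d' : V → ℕ, IsRootedForest (Function.update f u v) d' ∧
      (∀ x, d x ≤ d' x) ∧ d u < d' u := by
  classical
  have huv : v ≠ u := by
    rintro rfl
    exact hvu (IsAncestor.refl _ _)
  refine ⟨fun x => if IsAncestor f u x then d x + (d v + 1 - d u) else d x, ⟨?_, ?_⟩, ?_, ?_⟩
  · intro x hx
    by_cases hxu : x = u
    · subst hxu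
      simp [huv] at hx
    · rw [Function.update_of_ne hxu] at hx
      have : ¬ IsAncestor f u x := by
        rintro ⟨j, hj⟩
        rw [Function.iterate_fixed hx] at hj
        exact hxu hj
      simp [this, h.root x hx]
  · intro x hx
    by_cases hxu : x = u
    · subst hxu
      simp only [IsAncestor.refl, if_true, Function.update_self, hvu, if_false]
      omega
    · rw [Function.update_of_ne hxu] at hx ⊢
      have h1 := h.succ x hx
      have h2 := isAncestor_iff_of_ne (f := f) hxu
      by_cases h3 : IsAncestor f u x
      · simp only [h3, h2.1 h3, if_true]
        omega
      · have h4 : ¬ IsAncestor f u (f x) := fun h4 => h3 (h2.2 h4)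
        simp only [h3, h4, if_false]
        omega
  · intro x
    dsimp only
    split_ifs <;> omega
  · simp only [IsAncestor.refl, if_true]
    omega

end IsRootedForest

/-- Every finite graph `H` has a normal spanning forest: a rooted spanning forest such that each
edge of `H` joins a vertex to one of its ancestors. A rooted spanning forest of maximal total depth
is normal, as an edge between incomparable vertices would allow a subtree to be re-hung deeper. -/
theorem exists_normal_forest {V : Type u} [Finite V] (H : SimpleGraph V) :
    ∃ (f : V → V) (d : V → ℕ), IsRootedForest f d ∧ (∀ v, f v ≠ v → H.Adj v (f v)) ∧
      ∀ u v, H.Adj u v → IsAncestor f u v ∨ IsAncestor f v u := by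
  classical
  have := Fintype.ofFinite V
  let T : Set (V → V) := {f | (∃ d, IsRootedForest f d) ∧ ∀ v, f v ≠ v → H.Adj v (f v)}
  let g : (V → V) → ℕ := fun f =>
    if hf : ∃ d, IsRootedForest f d then ∑ v, hf.choose v else 0
  have hg : ∀ f d, IsRootedForest f d → g f = ∑ v, d v := by
    intro f d hfd
    have hex : ∃ d, IsRootedForest f d := ⟨d, hfd⟩
    simp only [g, dif_pos hex, hfd.depth_unique hex.choose_spec]
  have hne : T.Nonempty := ⟨id, ⟨fun _ => 0, fun _ _ => rfl, fun v hv => absurd rfl hv⟩,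
    fun v hv => absurd rfl hv⟩
  obtain ⟨f, ⟨⟨d, hfd⟩, hadj⟩, hmax⟩ := Set.exists_max_image T g (Set.toFinite T) hne
  have key : ∀ u v, H.Adj u v → d u ≤ d v → IsAncestor f u v := by
    intro u v huv hd
    by_contra hvu
    obtain ⟨d', h1, h2, h3⟩ := hfd.rehang hvu hd
    have h4 : Function.update f u v ∈ T := by
      refine ⟨⟨d', h1⟩, fun x hx => ?_⟩
      by_cases hxu : x = u
      · subst hxu
        simpa using huv
      · rw [Function.update_of_ne hxu] at hx ⊢
        exact hadj x hx
    have h5 := hmax _ h4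
    rw [hg _ _ hfd, hg _ _ h1] at h5
    exact absurd h5 (not_le.2 (Finset.sum_lt_sum (fun x _ => h2 x) ⟨u, Finset.mem_univ u, h3⟩))
  refine ⟨f, d, hfd, hadj, fun u v huv => ?_⟩
  rcases le_total (d u) (d v) with hd | hd
  · exact Or.inl (key u v huv hd)
  · exact Or.inr (key v u huv.symm hd)

/-! ### Long cycles from overlapping chords of a path -/

lemma SimpleGraph.Walk.IsPath.append_of_disjoint {V : Type u} {H : SimpleGraph V} {a b c : V}
    {p : H.Walk a b} {q : H.Walk b c} (hp : p.IsPath) (hq : q.IsPath)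
    (h : ∀ y, y ∈ p.support → y ∈ q.support → y = b) : (p.append q).IsPath := by
  rw [SimpleGraph.Walk.isPath_def, SimpleGraph.Walk.support_append, List.nodup_append]
  refine ⟨hp.support_nodup, hq.support_nodup.tail, ?_⟩
  rintro y hy z hz rfl
  have hb := h y hy (List.mem_of_mem_tail hz)
  subst hb
  have := hq.support_nodup
  rw [← SimpleGraph.Walk.cons_tail_support, List.nodup_cons] at this
  exact this.1 hz

/-- The part of a path between positions `a` and `b`. -/
lemma exists_segment {V : Type u} {H : SimpleGraph V} {x : ℕ → V} {m : ℕ}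
    (hinj : ∀ i j, i ≤ m → j ≤ m → x i = x j → i = j) (hadj : ∀ i < m, H.Adj (x i) (x (i + 1)))
    {a b : ℕ} (hab : a ≤ b) (hb : b ≤ m) :
    ∃ q : H.Walk (x a) (x b), q.IsPath ∧ q.length = b - a ∧
      ∀ y ∈ q.support, ∃ i, a ≤ i ∧ i ≤ b ∧ y = x i := by
  induction b, hab using Nat.le_induction with
  | base => exact ⟨.nil, by simp, by simp, fun y hy => ⟨a, le_rfl, le_rfl, by simpa using hy⟩⟩
  | succ b hab ih =>
    obtain ⟨q, h1, h2, h3⟩ := ih (by omega)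
    refine ⟨q.concat (hadj b (by omega)), ?_, ?_, ?_⟩
    · refine h1.concat (fun hmem => ?_) _
      obtain ⟨i, hi1, hi2, hi3⟩ := h3 _ hmem
      have := hinj _ _ hb (by omega) hi3
      omega
    · rw [SimpleGraph.Walk.length_concat, h2]
      omega
    · intro y hy
      rw [SimpleGraph.Walk.support_concat, List.mem_append, List.mem_singleton] at hy
      rcases hy with hy | rfl
      · obtain ⟨i, hi1, hi2, hi3⟩ := h3 _ hy
        exact ⟨i, hi1, by omega, hi3⟩
      · exact ⟨b + 1, by omega, le_rfl, rfl⟩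

/-- A single chord closes a cycle through the part of the path that it spans. -/
lemma exists_cycle_of_chord {V : Type u} {H : SimpleGraph V} {x : ℕ → V} {m : ℕ}
    (hinj : ∀ i j, i ≤ m → j ≤ m → x i = x j → i = j) (hadj : ∀ i < m, H.Adj (x i) (x (i + 1)))
    (hm : 2 ≤ m) (hchord : H.Adj (x 0) (x m)) :
    ∃ (v : V) (q : H.Walk v v), q.IsCycle ∧ m ≤ q.length := by
  obtain ⟨q, h1, h2, h3⟩ := exists_segment hinj hadj (a := 1) (b := m) (by omega) le_rfl
  have h0 : x 0 ∉ q.support := fun h => by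
    obtain ⟨i, hi1, hi2, hi3⟩ := h3 _ h
    have := hinj _ _ (by omega) hi2 hi3
    omega
  have hp : (q.concat hchord.symm).IsPath := h1.concat h0 _
  refine ⟨x 0, .cons (hadj 0 (by omega)) (q.concat hchord.symm), ?_, ?_⟩
  · rw [SimpleGraph.Walk.cons_isCycle_iff]
    refine ⟨hp, fun he => ?_⟩
    rw [SimpleGraph.Walk.edges_concat, List.concat_eq_append, List.mem_append, List.mem_singleton] at he
    rcases he with he | he
    · exact h0 (q.fst_mem_support_of_mem_edges he)
    · rw [Sym2.eq_swap, Sym2.eq_iff] at he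
      rcases he with ⟨he, -⟩ | ⟨he, he'⟩
      · have := hinj _ _ (by omega) le_rfl he
        omega
      · have := hinj _ _ (by omega) (by omega) he
        omega
  · simp only [SimpleGraph.Walk.length_cons, SimpleGraph.Walk.length_concat]
    omega

/-- If every window of `w` consecutive positions of a path is the start of a chord of length at
least `s ≥ 4 w`, then these chords can be strung together: each new chord starts just before the
end of the last one, and the two tracks that arise, together with the last stretch of the path,
form a cycle that misses less than half of the vertices.
The two tracks are kept as one path `q` from position `a` to position `b`, the ends of the last two
chords; it uses no position beyond `a` except `b`. -/
lemma exists_cycle_of_chords {V : Type u} {H : SimpleGraph V} {x : ℕ → V} {m w s M : ℕ}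
    (hinj : ∀ i j, i ≤ m → j ≤ m → x i = x j → i = j) (hadj : ∀ i < m, H.Adj (x i) (x (i + 1)))
    (hw : 1 ≤ w) (hs : 4 * w ≤ s) (hwM : w ≤ M)
    (hchord : ∀ t, w ≤ t → t ≤ M → ∃ i j, t ≤ i + w ∧ i < t ∧ i + s ≤ j ∧ j ≤ m ∧
      H.Adj (x i) (x j)) :
    ∃ (v : V) (q : H.Walk v v), q.IsCycle ∧ M ≤ 2 * q.length + w := by
  have key : ∀ n, ∃ a b : ℕ, a + 2 * w ≤ b ∧ b ≤ m ∧ (n ≤ b ∨ M < b) ∧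
      ∃ q : H.Walk (x a) (x b), q.IsPath ∧ (∀ y ∈ q.support, (∃ i ≤ a, y = x i) ∨ y = x b) ∧
        b ≤ 2 * (q.length + (b - a)) + w := by
    intro n
    induction n with
    | zero =>
      obtain ⟨i, j, h1, h2, h3, h4, h5⟩ := hchord w le_rfl hwM
      refine ⟨i, j, by omega, h4, by omega, .cons h5 .nil, ?_, ?_, ?_⟩
      · simp [h5.ne]
      · intro y hy
        simp only [SimpleGraph.Walk.support_cons, SimpleGraph.Walk.support_nil, List.mem_cons,
          List.not_mem_nil, or_false] at hy
        rcases hy with rfl | rfl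
        · exact Or.inl ⟨i, le_rfl, rfl⟩
        · exact Or.inr rfl
      · simp only [SimpleGraph.Walk.length_cons, SimpleGraph.Walk.length_nil]
        omega
    | succ n ih =>
      obtain ⟨a, b, hab, hb, hn, q, hq, hsupp, hlen⟩ := ih
      by_cases hbM : M < b
      · exact ⟨a, b, hab, hb, Or.inr hbM, q, hq, hsupp, hlen⟩
      obtain ⟨i, j, h1, h2, h3, h4, h5⟩ := hchord b (by omega) (by omega)
      obtain ⟨r, hr, hrlen, hrsupp⟩ := exists_segment hinj hadj (a := a) (b := i) (by omega)
        (by omega)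
      have hpath : (q.reverse.append r).IsPath := by
        refine hq.reverse.append_of_disjoint hr fun y hy hy' => ?_
        rw [SimpleGraph.Walk.support_reverse, List.mem_reverse] at hy
        obtain ⟨l, hl1, hl2, rfl⟩ := hrsupp y hy'
        rcases hsupp _ hy with ⟨l', hl', he⟩ | he
        · have := hinj _ _ (by omega) (by omega) he
          congr 1
          omega
        · have := hinj _ _ (by omega) (by omega) he
          omega
      have hsupp' : ∀ y ∈ (q.reverse.append r).support, ∃ l ≤ b, y = x l := by
        intro y hy
        rw [SimpleGraph.Walk.mem_support_append_iff, SimpleGraph.Walk.support_reverse,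
          List.mem_reverse] at hy
        rcases hy with hy | hy
        · rcases hsupp y hy with ⟨l, hl, rfl⟩ | rfl
          · exact ⟨l, by omega, rfl⟩
          · exact ⟨b, le_rfl, rfl⟩
        · obtain ⟨l, hl1, hl2, rfl⟩ := hrsupp y hy
          exact ⟨l, by omega, rfl⟩
      refine ⟨b, j, by omega, h4, by omega, (q.reverse.append r).concat h5, ?_, ?_, ?_⟩
      · refine hpath.concat (fun hmem => ?_) _
        obtain ⟨l, hl, he⟩ := hsupp' _ hmem
        have := hinj _ _ (by omega) (by omega) he
        omega
      · intro y hy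
        rw [SimpleGraph.Walk.support_concat, List.mem_append, List.mem_singleton] at hy
        exact hy.imp (hsupp' y) id
      · rw [SimpleGraph.Walk.length_concat, SimpleGraph.Walk.length_append,
          SimpleGraph.Walk.length_reverse, hrlen]
        omega
  obtain ⟨a, b, hab, hb, hn, q, hq, hsupp, hlen⟩ := key (M + 1)
  obtain ⟨r, hr, hrlen, hrsupp⟩ := exists_segment hinj hadj (a := a + 1) (b := b) (by omega) hb
  have hpath : (r.append q.reverse).IsPath := by
    refine hr.append_of_disjoint hq.reverse fun y hy' hy => ?_
    rw [SimpleGraph.Walk.support_reverse, List.mem_reverse] at hy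
    obtain ⟨l, hl1, hl2, rfl⟩ := hrsupp y hy'
    rcases hsupp _ hy with ⟨l', hl', he⟩ | he
    · have := hinj _ _ (by omega) (by omega) he
      omega
    · exact he
  refine ⟨x a, .cons (hadj a (by omega)) (r.append q.reverse), ?_, ?_⟩
  · rw [SimpleGraph.Walk.cons_isCycle_iff]
    refine ⟨hpath, fun he => ?_⟩
    rw [SimpleGraph.Walk.edges_append, List.mem_append, SimpleGraph.Walk.edges_reverse,
      List.mem_reverse] at he
    rcases he with he | he
    · obtain ⟨l, hl1, hl2, he'⟩ := hrsupp _ (r.fst_mem_support_of_mem_edges he)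
      have := hinj _ _ (by omega) (by omega) he'
      omega
    · rcases hsupp _ (q.snd_mem_support_of_mem_edges he) with ⟨l, hl, he'⟩ | he'
      · have := hinj _ _ (by omega) (by omega) he'
        omega
      · have := hinj _ _ (by omega) (by omega) he'
        omega
  · rw [SimpleGraph.Walk.length_cons, SimpleGraph.Walk.length_append,
      SimpleGraph.Walk.length_reverse, hrlen]
    omega

/-! ### Counting descendants in a rooted forest -/

section Counting

open Finset Classical

variable {V : Type u} [Fintype V]

/-- The descendants of `v` (including `v`) at most `L` levels below `v`. -/
noncomputable def descendantsWithin (f : V → V) (d : V → ℕ) (L : ℕ) (v : V) : Finset V :=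
  {x | IsAncestor f v x ∧ d x ≤ d v + L}

/-- The vertices without descendants exactly `L` levels below them, that is, those of height less
than `L`. -/
noncomputable def lowVertices (f : V → V) (d : V → ℕ) (L : ℕ) : Finset V :=
  {v | ¬ ∃ x, IsAncestor f v x ∧ d x = d v + L}

/-- The vertices with fewer than `q` descendants, themselves included. -/
noncomputable def poorVertices (f : V → V) (q : ℕ) : Finset V :=
  {v | #{x | IsAncestor f v x} < q}

/-- The vertices with at least `q` more descendants on the next `ℓ` levels than a path has. -/
noncomputable def heavyVertices (f : V → V) (d : V → ℕ) (ℓ q : ℕ) : Finset V :=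
  {v | ℓ + 1 + q ≤ #(descendantsWithin f d ℓ v)}

variable {f : V → V} {d : V → ℕ}

namespace IsRootedForest

lemma depth_lt_of_mem_lowVertices (h : IsRootedForest f d) {L : ℕ} {v x : V}
    (hv : v ∈ lowVertices f d L) (hx : IsAncestor f v x) : d x < d v + L := by
  by_contra hlt
  have hle := h.depth_le hx
  have h1 := h.depth_iterate x (d x - (d v + L)) (by omega)
  refine (mem_filter.1 hv).2 ⟨f^[d x - (d v + L)] x, ?_, by omega⟩
  refine ⟨L, ?_⟩
  rw [← Function.iterate_add_apply]
  refine (congrArg (fun j => f^[j] x) ?_).trans (h.iterate_sub_depth hx)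
  omega

lemma le_card_descendantsWithin (h : IsRootedForest f d) {L ℓ : ℕ} (hℓ : ℓ ≤ L) {v : V}
    (hv : v ∉ lowVertices f d L) : ℓ + 1 ≤ #(descendantsWithin f d ℓ v) := by
  simp only [lowVertices, mem_filter, mem_univ, true_and, not_not] at hv
  obtain ⟨x, hx, hd⟩ := hv
  have hfx : f^[L] x = v := by
    have := h.iterate_sub_depth hx
    rwa [hd, Nat.add_sub_cancel_left] at this
  rw [← card_range (ℓ + 1)]
  refine card_le_card_of_injOn (fun j => f^[L - ℓ + j] x) ?_ ?_
  · intro j hj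
    have hj := mem_range.1 hj
    have h1 := h.depth_iterate x (L - ℓ + j) (by omega)
    refine mem_filter.2 ⟨mem_univ _, ⟨ℓ - j, ?_⟩, by dsimp only; omega⟩
    rw [← Function.iterate_add_apply, ← hfx]
    congr 2
    omega
  · intro i hi j hj hij
    have hi := mem_range.1 hi
    have hj := mem_range.1 hj
    have := h.iterate_injOn x (by omega) (by omega) hij
    omega

/-- Double counting of the pairs of a vertex and a vertex of `B` at most `L` levels above it. -/
lemma sum_card_descendantsWithin (h : IsRootedForest f d) (L : ℕ) (B : Finset V) :
    ∑ v ∈ B, #(descendantsWithin f d L v) =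
      ∑ x, #{j ∈ range (L + 1) | j ≤ d x ∧ f^[j] x ∈ B} := by
  have h1 := sum_card_bipartiteAbove_eq_sum_card_bipartiteBelow (s := B) (t := univ)
    (fun v x => IsAncestor f v x ∧ d x ≤ d v + L)
  refine h1.trans (sum_congr rfl fun x _ => ?_)
  symm
  refine card_bij (fun j _ => f^[j] x) ?_ ?_ ?_
  · intro j hj
    obtain ⟨hj1, hj2, hj3⟩ := mem_filter.1 hj
    have hj1 := mem_range.1 hj1
    have := h.depth_iterate x j hj2
    exact mem_filter.2 ⟨hj3, isAncestor_iterate f j x, by omega⟩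
  · intro i hi j hj hij
    exact h.iterate_injOn x (mem_filter.1 hi).2.1 (mem_filter.1 hj).2.1 hij
  · intro v hv
    obtain ⟨hv1, hv2, hv3⟩ := mem_filter.1 hv
    have h2 := h.iterate_sub_depth hv2
    refine ⟨d x - d v, mem_filter.2 ⟨mem_range.2 (by omega), by omega, by rwa [h2]⟩, h2⟩

lemma sum_card_descendantsWithin_le (h : IsRootedForest f d) (L : ℕ) :
    ∑ v, #(descendantsWithin f d L v) ≤ Fintype.card V * (L + 1) := by
  rw [h.sum_card_descendantsWithin L univ, ← card_univ, ← smul_eq_mul]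
  refine sum_le_card_nsmul _ _ _ fun x _ => ?_
  exact (card_filter_le _ _).trans (card_range _).le

/-- Low vertices are rare if poor vertices are: the deepest non-poor descendant of a low vertex that
is not poor has only poor vertices strictly below it, and a poor vertex has few low ancestors. -/
lemma card_lowVertices_sdiff_mul_le (h : IsRootedForest f d) (L q : ℕ) :
    #(lowVertices f d L \ poorVertices f q) * (q - 1) ≤ #(poorVertices f q) * L := by
  refine card_mul_le_card_mul (IsAncestor f) ?_ ?_
  · intro v hv
    obtain ⟨-, hv⟩ := mem_sdiff.1 hv
    obtain ⟨x, hx, hmax⟩ := exists_max_image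
      ({x | IsAncestor f v x ∧ x ∉ poorVertices f q} : Finset V) d
      ⟨v, mem_filter.2 ⟨mem_univ _, IsAncestor.refl f v, hv⟩⟩
    obtain ⟨-, hx1, hx2⟩ := mem_filter.1 hx
    have hx3 : q ≤ #{y | IsAncestor f x y} := by
      by_contra hlt
      exact hx2 (mem_filter.2 ⟨mem_univ _, not_le.1 hlt⟩)
    calc q - 1 ≤ #(({y | IsAncestor f x y} : Finset V).erase x) := by
          rw [card_erase_of_mem (mem_filter.2 ⟨mem_univ _, IsAncestor.refl f x⟩)]
          exact Nat.sub_le_sub_right (hx3.trans (le_of_eq (by congr))) 1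
      _ ≤ _ := by
          refine card_le_card fun y hy => ?_
          obtain ⟨hy1, hy2⟩ := mem_erase.1 hy
          have hy2 := (mem_filter.1 hy2).2
          refine mem_filter.2 ⟨?_, hx1.trans hy2⟩
          by_contra hy3
          have h1 := hmax y (mem_filter.2 ⟨mem_univ _, hx1.trans hy2, hy3⟩)
          exact hy1 (h.eq_of_isAncestor_of_depth_eq hy2 (le_antisymm (h.depth_le hy2) h1)).symm
  · intro y hy
    refine le_trans ?_ (card_range L).le
    refine card_le_card_of_injOn (fun v => d y - d v) ?_ ?_
    · intro v hv
      obtain ⟨hv1, hv2⟩ := mem_filter.1 hv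
      have := h.depth_lt_of_mem_lowVertices (mem_sdiff.1 hv1).1 hv2
      have := h.depth_le hv2
      exact mem_coe.2 (mem_range.2 (by dsimp only; omega))
    · intro v hv v' hv' he
      obtain ⟨-, hv⟩ := mem_filter.1 hv
      obtain ⟨-, hv'⟩ := mem_filter.1 hv'
      rw [← h.iterate_sub_depth hv, ← h.iterate_sub_depth hv']
      exact congrArg (fun j => f^[j] y) he

/-- The numbers of descendants on the next `ℓ` levels are at most `ℓ + 1` on average, and at least
`ℓ + 1` for each vertex that is not low. -/
lemma card_heavyVertices_sdiff_mul_le (h : IsRootedForest f d) {L ℓ : ℕ} (hℓ : ℓ ≤ L) (q : ℕ) :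
    #(heavyVertices f d ℓ q \ lowVertices f d L) * q ≤ #(lowVertices f d L) * (ℓ + 1) := by
  have h1 := h.sum_card_descendantsWithin_le ℓ
  have h2 : ∑ v ∈ (lowVertices f d L)ᶜ, (ℓ + 1 + if v ∈ heavyVertices f d ℓ q then q else 0) ≤
      ∑ v, #(descendantsWithin f d ℓ v) := by
    refine le_trans (sum_le_sum fun v hv => ?_) (sum_le_sum_of_subset (subset_univ _))
    split_ifs with hvh
    · exact (mem_filter.1 hvh).2
    · exact h.le_card_descendantsWithin hℓ (mem_compl.1 hv)
  have h3 : ({v ∈ (lowVertices f d L)ᶜ | v ∈ heavyVertices f d ℓ q} : Finset V) =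
      heavyVertices f d ℓ q \ lowVertices f d L := by
    ext v
    simp [and_comm]
  rw [sum_add_distrib, ← sum_filter, h3, sum_const, sum_const, smul_eq_mul, smul_eq_mul] at h2
  have h4 := card_add_card_compl (lowVertices f d L)
  rw [← h4, add_mul] at h1
  omega

/-- If a set `B` contains all low vertices, then some vertex `x` has, among the positions `0, …, L`
of the path from `x` to its root, at least the average proportion of vertices outside `B`. -/
lemma exists_path_avoiding (h : IsRootedForest f d) [Nonempty V] (L : ℕ) (B : Finset V)
    (hB : lowVertices f d L ⊆ B) :
    ∃ x, (L + 1) * Fintype.card V ≤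
      #{j ∈ range (L + 1) | j ≤ d x ∧ f^[j] x ∉ B} * Fintype.card V + (L + 1) * #B := by
  have h1 := h.sum_card_descendantsWithin L Bᶜ
  have h2 : ∑ _v ∈ Bᶜ, (L + 1) ≤ ∑ v ∈ Bᶜ, #(descendantsWithin f d L v) :=
    sum_le_sum fun v hv => h.le_card_descendantsWithin le_rfl fun hv' => mem_compl.1 hv (hB hv')
  rw [h1, sum_const, smul_eq_mul] at h2
  simp only [mem_compl] at h2
  have h3 := card_add_card_compl B
  obtain ⟨x, -, hx⟩ := exists_max_image (univ : Finset V)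
    (fun x => #{j ∈ range (L + 1) | j ≤ d x ∧ f^[j] x ∉ B}) univ_nonempty
  have h4 := sum_le_card_nsmul _ _ _ hx
  rw [smul_eq_mul, card_univ] at h4
  refine ⟨x, ?_⟩
  calc (L + 1) * Fintype.card V = (L + 1) * #B + #Bᶜ * (L + 1) := by rw [← h3]; ring
    _ ≤ _ := by
      have := h2.trans h4
      rw [mul_comm] at this
      linarith

end IsRootedForest

end Counting

/-! ### A path with many short chords everywhere -/

section Chords

open Finset Classical

variable {V : Type u} [Fintype V]

/-- `x` and `y` lie on a common path to a root, at distance at most `ℓ` in the forest. -/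
def IsShortPair (f : V → V) (d : V → ℕ) (ℓ : ℕ) (x y : V) : Prop :=
  (IsAncestor f x y ∧ d y ≤ d x + ℓ) ∨ (IsAncestor f y x ∧ d x ≤ d y + ℓ)

/-- The neighbours of `x` that are incomparable to `x` or far from `x` in the forest. -/
noncomputable def nonshortNeighbors (G : SimpleGraph V) (f : V → V) (d : V → ℕ) (ℓ : ℕ) (x : V) :
    Finset V :=
  {y | G.Adj x y ∧ ¬ IsShortPair f d ℓ x y}

/-- The vertices with more than `2 * q` neighbours that are incomparable or far. -/
noncomputable def scatteredVertices (G : SimpleGraph V) (f : V → V) (d : V → ℕ) (ℓ q : ℕ) :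
    Finset V :=
  {x | 2 * q < #(nonshortNeighbors G f d ℓ x)}

/-- The heights above `x` at which the path from `x` to its root meets a neighbour of `x`. -/
noncomputable def chordHeights (G : SimpleGraph V) (f : V → V) (d : V → ℕ) (ℓ : ℕ) (x : V) :
    Finset ℕ :=
  {j ∈ range (ℓ + 1) | 1 ≤ j ∧ j ≤ d x ∧ G.Adj x (f^[j] x)}

variable {G : SimpleGraph V} {f : V → V} {d : V → ℕ}

namespace IsRootedForest

lemma card_neighbors_le (h : IsRootedForest f d) (ℓ : ℕ) (x : V) :
    #{y | G.Adj x y} + 1 ≤ #(nonshortNeighbors G f d ℓ x) + #(chordHeights G f d ℓ x) +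
      #(descendantsWithin f d ℓ x) := by
  have hx : x ∈ descendantsWithin f d ℓ x :=
    mem_filter.2 ⟨mem_univ _, IsAncestor.refl f x, by omega⟩
  have h1 : ({y | G.Adj x y} : Finset V) ⊆ nonshortNeighbors G f d ℓ x ∪
      (chordHeights G f d ℓ x).image (fun j => f^[j] x) ∪ (descendantsWithin f d ℓ x).erase x := by
    intro y hy
    have hy := (mem_filter.1 hy).2
    by_cases hs : IsShortPair f d ℓ x y
    · rcases hs with ⟨hs1, hs2⟩ | ⟨hs1, hs2⟩
      · exact mem_union_right _ (mem_erase.2 ⟨hy.ne', mem_filter.2 ⟨mem_univ _, hs1, hs2⟩⟩)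
      · refine mem_union_left _ (mem_union_right _ (mem_image.2
          ⟨d x - d y, ?_, h.iterate_sub_depth hs1⟩))
        have h2 : d x ≠ d y := fun he => hy.ne' (h.eq_of_isAncestor_of_depth_eq hs1 he.symm)
        have h3 := h.depth_le hs1
        refine mem_filter.2 ⟨mem_range.2 (by omega), by omega, by omega, ?_⟩
        rwa [h.iterate_sub_depth hs1]
    · exact mem_union_left _ (mem_union_left _ (mem_filter.2 ⟨mem_univ _, hy, hs⟩))
  have h2 := card_le_card h1
  have h3 := card_union_le (nonshortNeighbors G f d ℓ x ∪
      (chordHeights G f d ℓ x).image (fun j => f^[j] x)) ((descendantsWithin f d ℓ x).erase x)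
  have h4 := card_union_le (nonshortNeighbors G f d ℓ x)
      ((chordHeights G f d ℓ x).image (fun j => f^[j] x))
  have h5 := card_image_le (s := chordHeights G f d ℓ x) (f := fun j => f^[j] x)
  have h6 := card_erase_add_one hx
  omega

lemma poorVertices_subset (h : IsRootedForest f d) {k q ℓ : ℕ} (hk : ∀ x, k ≤ #{y | G.Adj x y})
    (hℓ : ℓ + 3 * q ≤ k) : poorVertices f q ⊆ scatteredVertices G f d ℓ q := by
  intro x hx
  have hx := (mem_filter.1 hx).2
  refine mem_filter.2 ⟨mem_univ _, ?_⟩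
  have h1 := h.card_neighbors_le (G := G) ℓ x
  have h2 : #(chordHeights G f d ℓ x) ≤ #(Icc 1 ℓ) := by
    refine card_le_card fun j hj => ?_
    obtain ⟨hj1, hj2, -⟩ := mem_filter.1 hj
    have := mem_range.1 hj1
    exact mem_Icc.2 ⟨hj2, by omega⟩
  rw [Nat.card_Icc] at h2
  have h3 : #(descendantsWithin f d ℓ x) ≤ #{y | IsAncestor f x y} :=
    card_le_card fun y hy => mem_filter.2 ⟨mem_univ _, (mem_filter.1 hy).2.1⟩
  have h4 := hk x
  omega

lemma le_card_high_chordHeights (h : IsRootedForest f d) {k q ℓ : ℕ}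
    (hk : ∀ x, k ≤ #{y | G.Adj x y}) (hℓ : ℓ + 5 * q ≤ k) {x : V}
    (hx : x ∉ scatteredVertices G f d ℓ q) (hx' : x ∉ heavyVertices f d ℓ q) :
    q ≤ #{j ∈ chordHeights G f d ℓ x | q ≤ j} := by
  have h1 := h.card_neighbors_le (G := G) ℓ x
  have h2 : #(nonshortNeighbors G f d ℓ x) ≤ 2 * q := by
    by_contra hlt
    exact hx (mem_filter.2 ⟨mem_univ _, not_le.1 hlt⟩)
  have h3 : #(descendantsWithin f d ℓ x) < ℓ + 1 + q := by
    by_contra hlt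
    exact hx' (mem_filter.2 ⟨mem_univ _, not_lt.1 hlt⟩)
  have h4 := card_filter_add_card_filter_not (s := chordHeights G f d ℓ x) (fun j => q ≤ j)
  have h5 : #{j ∈ chordHeights G f d ℓ x | ¬ q ≤ j} ≤ q := by
    refine le_trans (card_le_card fun j hj => ?_) (card_range q).le
    exact mem_range.2 (not_le.1 (mem_filter.1 hj).2)
  have h6 := hk x
  omega

lemma card_scatteredVertices_mul_le (ℓ q : ℕ) :
    #(scatteredVertices G f d ℓ q) * (2 * q) ≤ ∑ x, #(nonshortNeighbors G f d ℓ x) := by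
  rw [← smul_eq_mul]
  refine (card_nsmul_le_sum _ _ _ fun x hx => (mem_filter.1 hx).2.le).trans ?_
  exact sum_le_sum_of_subset (subset_univ _)

/-- The vertices that do not send `q` edges far up the forest are rare. -/
lemma card_bad_le (h : IsRootedForest f d) {k q ℓ : ℕ} (hk : ∀ x, k ≤ #{y | G.Adj x y})
    (hℓ : ℓ + 5 * q = k) (hq : 2 ≤ q) :
    #(scatteredVertices G f d ℓ q ∪ lowVertices f d (6 * k) ∪ heavyVertices f d ℓ q) *
      (2 * q ^ 3) ≤ 27 * k ^ 2 * ∑ x, #(nonshortNeighbors G f d ℓ x) := by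
  set Y := scatteredVertices G f d ℓ q
  set A := lowVertices f d (6 * k)
  set B := heavyVertices f d ℓ q
  set P := poorVertices f q
  set N := ∑ x, #(nonshortNeighbors G f d ℓ x)
  have hY : #Y * (2 * q) ≤ N := card_scatteredVertices_mul_le ℓ q
  have hP : #P ≤ #Y := card_le_card (h.poorVertices_subset hk (by omega))
  have hAP : #(A \ P) * (q - 1) ≤ #P * (6 * k) := h.card_lowVertices_sdiff_mul_le _ _
  have hB : #(B \ A) * q ≤ #A * (ℓ + 1) := h.card_heavyVertices_sdiff_mul_le (by omega) q
  have hA : #A ≤ #(A \ P) + #P := by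
    rw [← card_sdiff_add_card_inter A P]
    exact Nat.add_le_add_left (card_le_card inter_subset_right) _
  have hU : #(Y ∪ A ∪ B) ≤ #Y + #A + #(B \ A) := by
    calc #(Y ∪ A ∪ B) = #((Y ∪ A) ∪ (B \ A)) := by
          congr 1
          ext x
          simp only [mem_union, Finset.mem_sdiff]
          tauto
      _ ≤ _ := (card_union_le _ _).trans (Nat.add_le_add_right (card_union_le _ _) _)
  have h1 : #(A \ P) * q ≤ 12 * k * #Y := by
    calc #(A \ P) * q ≤ #(A \ P) * (2 * (q - 1)) := Nat.mul_le_mul_left _ (by omega)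
      _ = 2 * (#(A \ P) * (q - 1)) := by ring
      _ ≤ 2 * (#P * (6 * k)) := Nat.mul_le_mul_left _ hAP
      _ = 12 * k * #P := by ring
      _ ≤ 12 * k * #Y := Nat.mul_le_mul_left _ hP
  have h2 : #A * q ≤ 13 * k * #Y := by
    calc #A * q ≤ (#(A \ P) + #P) * q := Nat.mul_le_mul_right _ hA
      _ = #(A \ P) * q + #P * q := by ring
      _ ≤ 12 * k * #Y + #Y * k := Nat.add_le_add h1 (Nat.mul_le_mul hP (by omega))
      _ = _ := by ring
  have h3 : #(B \ A) * q ^ 2 ≤ 13 * k ^ 2 * #Y := by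
    calc #(B \ A) * q ^ 2 = #(B \ A) * q * q := by ring
      _ ≤ #A * (ℓ + 1) * q := Nat.mul_le_mul_right _ hB
      _ = #A * q * (ℓ + 1) := by ring
      _ ≤ 13 * k * #Y * k := Nat.mul_le_mul h2 (by omega)
      _ = _ := by ring
  have h4 : #(Y ∪ A ∪ B) * q ^ 2 ≤ 27 * k ^ 2 * #Y := by
    have hqk : q ≤ k := by omega
    calc #(Y ∪ A ∪ B) * q ^ 2 ≤ (#Y + #A + #(B \ A)) * q ^ 2 := Nat.mul_le_mul_right _ hU
      _ = #Y * q ^ 2 + #A * q * q + #(B \ A) * q ^ 2 := by ring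
      _ ≤ #Y * k ^ 2 + 13 * k * #Y * k + 13 * k ^ 2 * #Y := by gcongr
      _ = _ := by ring
  calc #(Y ∪ A ∪ B) * (2 * q ^ 3) = #(Y ∪ A ∪ B) * q ^ 2 * (2 * q) := by ring
    _ ≤ 27 * k ^ 2 * #Y * (2 * q) := Nat.mul_le_mul_right _ h4
    _ = 27 * k ^ 2 * (#Y * (2 * q)) := by ring
    _ ≤ _ := Nat.mul_le_mul_left _ hY

/-- If almost all edges of `G` join vertices that are comparable and close in the forest, then some
path of the forest of length at least `5 * k` has `q ^ 2 / 8` chords of length at least `q` starting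
from each of its windows of length `q / 4`. -/
theorem exists_path_with_chords (h : IsRootedForest f d) [Nonempty V] {k q ℓ : ℕ}
    (hk : ∀ x, k ≤ #{y | G.Adj x y}) (hℓ : ℓ + 5 * q = k) (hq : 100 ≤ q)
    (hN : 2000 * k ^ 3 * ∑ x, #(nonshortNeighbors G f d ℓ x) ≤ q ^ 4 * Fintype.card V) :
    ∃ (x : V) (m : ℕ), m ≤ d x ∧ 5 * k ≤ m ∧ m ≤ 6 * k ∧ ∀ t, q / 4 ≤ t → t + k ≤ m →
      q ^ 2 ≤ 8 * #{e ∈ range (m + 1) ×ˢ range (m + 1) |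
        t ≤ e.1 + q / 4 ∧ e.1 < t ∧ e.1 + q ≤ e.2 ∧ G.Adj (f^[e.1] x) (f^[e.2] x)} := by
  have hbad := h.card_bad_le hk hℓ (by omega)
  set N := ∑ x, #(nonshortNeighbors G f d ℓ x)
  set n := Fintype.card V with hn
  have hn0 : 0 < n := Fintype.card_pos
  have hk0 : 0 < k := by omega
  have hq0 : 0 < q := by omega
  set U := scatteredVertices G f d ℓ q ∪ lowVertices f d (6 * k) ∪ heavyVertices f d ℓ q with hU
  obtain ⟨x, hx⟩ := h.exists_path_avoiding (6 * k) U
    (subset_union_right.trans subset_union_left)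
  set good : Finset ℕ := {j ∈ range (6 * k + 1) | j ≤ d x ∧ f^[j] x ∉ U} with hgood
  have hgc : #good ≤ 6 * k + 1 := (card_filter_le _ _).trans (card_range _).le
  -- `b` counts the positions up to `6 * k` that are bad or lie beyond the root.
  obtain ⟨b, hb⟩ := Nat.exists_eq_add_of_le hgc
  have hb1 : b * n ≤ (6 * k + 1) * #U := by
    have hx' : (#good + b) * n ≤ #good * n + (6 * k + 1) * #U := by
      rw [← hb]
      exact hx
    rw [add_mul] at hx'
    omega
  -- The constant `2000` in `hN` makes `b` so small that each window is mostly good.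
  have hb2 : 16 * b ≤ q := by
    have e1 : #U * (4000 * k) ≤ 27 * q * n := by
      refine Nat.le_of_mul_le_mul_right ?_ (pow_pos hq0 3)
      calc #U * (4000 * k) * q ^ 3 = 2000 * k * (#U * (2 * q ^ 3)) := by ring
        _ ≤ 2000 * k * (27 * k ^ 2 * N) := Nat.mul_le_mul_left _ hbad
        _ = 27 * (2000 * k ^ 3 * N) := by ring
        _ ≤ 27 * (q ^ 4 * n) := Nat.mul_le_mul_left _ hN
        _ = _ := by ring
    have e2 : 4000 * b ≤ 189 * q := by
      refine Nat.le_of_mul_le_mul_right ?_ hn0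
      calc 4000 * b * n = 4000 * (b * n) := by ring
        _ ≤ 4000 * ((6 * k + 1) * #U) := Nat.mul_le_mul_left _ hb1
        _ ≤ 4000 * ((7 * k) * #U) := by
          refine Nat.mul_le_mul_left _ (Nat.mul_le_mul_right _ (by omega))
        _ = 7 * (#U * (4000 * k)) := by ring
        _ ≤ 7 * (27 * q * n) := Nat.mul_le_mul_left _ e1
        _ = _ := by ring
    omega
  have hmd : 6 * k + 1 ≤ min (6 * k) (d x) + 1 + b := by
    have : #good ≤ #(range (min (6 * k) (d x) + 1)) := by
      refine card_le_card fun j hj => ?_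
      obtain ⟨hj1, hj2, -⟩ := mem_filter.1 hj
      have := mem_range.1 hj1
      exact mem_range.2 (by omega)
    rw [card_range] at this
    omega
  refine ⟨x, min (6 * k) (d x), min_le_right _ _, by omega, min_le_left _ _, fun t ht htk => ?_⟩
  set m := min (6 * k) (d x) with hm
  -- The good positions of the window.
  set W : Finset ℕ := {i ∈ Ico (t - q / 4) t | f^[i] x ∉ U} with hW
  have hWc : q ≤ 8 * #W := by
    have e1 : good ⊆ W ∪ (range (6 * k + 1) \ Ico (t - q / 4) t) := by
      intro j hj
      obtain ⟨hj1, hj2, hj3⟩ := mem_filter.1 hj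
      by_cases hj4 : j ∈ Ico (t - q / 4) t
      · exact mem_union_left _ (mem_filter.2 ⟨hj4, hj3⟩)
      · exact mem_union_right _ (mem_sdiff.2 ⟨hj1, hj4⟩)
    have e2 := (card_le_card e1).trans (card_union_le _ _)
    have e3 : #(range (6 * k + 1) \ Ico (t - q / 4) t) = 6 * k + 1 - q / 4 := by
      rw [card_sdiff_of_subset, card_range, Nat.card_Ico]
      · congr 1
        omega
      · intro j hj
        have := mem_Ico.1 hj
        exact mem_range.2 (by omega)
    omega
  have hch : ∀ i ∈ W, q ≤ #{j ∈ chordHeights G f d ℓ (f^[i] x) | q ≤ j} := by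
    intro i hi
    have hi := (mem_filter.1 hi).2
    refine h.le_card_high_chordHeights hk hℓ.le (fun h' => hi ?_) (fun h' => hi ?_)
    · exact mem_union_left _ (mem_union_left _ h')
    · exact mem_union_right _ h'
  have hsum : #W * q ≤ #(W.sigma fun i => {j ∈ chordHeights G f d ℓ (f^[i] x) | q ≤ j}) := by
    rw [card_sigma, ← smul_eq_mul]
    exact card_nsmul_le_sum _ _ _ hch
  have hinj : #(W.sigma fun i => {j ∈ chordHeights G f d ℓ (f^[i] x) | q ≤ j}) ≤
      #{e ∈ range (m + 1) ×ˢ range (m + 1) |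
        t ≤ e.1 + q / 4 ∧ e.1 < t ∧ e.1 + q ≤ e.2 ∧ G.Adj (f^[e.1] x) (f^[e.2] x)} := by
    refine card_le_card_of_injOn (fun e => (e.1, e.1 + e.2)) ?_ ?_
    · rintro ⟨i, j⟩ he
      obtain ⟨hi, hj⟩ := mem_sigma.1 he
      obtain ⟨hj, hqj⟩ := mem_filter.1 hj
      obtain ⟨hj1, -, -, hadj⟩ := mem_filter.1 hj
      have hi := mem_Ico.1 (mem_filter.1 hi).1
      have hj1 := mem_range.1 hj1
      dsimp only at hi hj1 hqj hadj ⊢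
      refine mem_filter.2 ⟨mem_product.2 ⟨mem_range.2 ?_, mem_range.2 ?_⟩, ?_, ?_, ?_, ?_⟩
      · dsimp only
        omega
      · dsimp only
        omega
      · dsimp only
        omega
      · exact hi.2
      · dsimp only
        omega
      · dsimp only
        rwa [add_comm i j, Function.iterate_add_apply]
    · rintro ⟨i, j⟩ - ⟨i', j'⟩ - he
      simp only [Prod.mk.injEq] at he
      obtain ⟨rfl, he⟩ := he
      simpa using he
  nlinarith

end IsRootedForest

end Chords

/-! ### Edge sets whose hitting forces a long cycle -/

section Hitting

open Finset Classical

variable {V : Type u}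

lemma card_le_two_mul_card_image_sym2 (C : Finset (V × V)) :
    #C ≤ 2 * #(C.image fun e => s(e.1, e.2)) := by
  refine card_le_mul_card_image C 2 fun e _ => ?_
  induction e with
  | _ a b =>
    refine le_trans (card_le_card (t := {(a, b), (b, a)}) ?_) card_le_two
    rintro ⟨x, y⟩ hxy
    have h := (mem_filter.1 hxy).2
    simp only [Sym2.eq_iff] at h
    simpa using h

variable {G H : SimpleGraph V} {f : V → V} {d : V → ℕ}

namespace IsRootedForest

lemma adj_iterate (h : IsRootedForest f d) (hf : ∀ v, f v ≠ v → H.Adj v (f v)) {x : V} {i : ℕ}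
    (hi : i < d x) : H.Adj (f^[i] x) (f^[i + 1] x) := by
  have h1 := h.depth_iterate x i hi.le
  rw [Function.iterate_succ_apply']
  exact hf _ (h.depth_parent (by omega)).1

lemma exists_cycle_of_isAncestor (h : IsRootedForest f d) (hf : ∀ v, f v ≠ v → H.Adj v (f v))
    {ℓ : ℕ} (hℓ : 1 ≤ ℓ) {x y : V} (hxy : H.Adj x y) (hyx : IsAncestor f y x)
    (hd : d y + ℓ < d x) : ∃ (v : V) (q : H.Walk v v), q.IsCycle ∧ ℓ ≤ q.length := by
  have hy := h.iterate_sub_depth hyx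
  obtain ⟨v, q, hq, hlen⟩ := exists_cycle_of_chord (H := H) (x := fun i => f^[i] x)
    (m := d x - d y) (fun i j hi hj hij => h.iterate_injOn x (by omega) (by omega) hij)
    (fun i hi => h.adj_iterate hf (by omega)) (by omega) (by simpa [hy] using hxy)
  exact ⟨v, q, hq, by omega⟩

end IsRootedForest

variable [Fintype V]

/-- The ordered pairs of adjacent vertices that are incomparable in the forest. -/
noncomputable def crossingPairs (G : SimpleGraph V) (f : V → V) : Finset (V × V) :=
  {e | G.Adj e.1 e.2 ∧ ¬ (IsAncestor f e.1 e.2 ∨ IsAncestor f e.2 e.1)}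

/-- The ordered pairs of adjacent vertices that are comparable, but far from each other in the
forest. -/
noncomputable def longPairs (G : SimpleGraph V) (f : V → V) (d : V → ℕ) (ℓ : ℕ) :
    Finset (V × V) :=
  {e | G.Adj e.1 e.2 ∧ (IsAncestor f e.1 e.2 ∨ IsAncestor f e.2 e.1) ∧
    ¬ IsShortPair f d ℓ e.1 e.2}

lemma sum_card_nonshortNeighbors_le (ℓ : ℕ) :
    ∑ x, #(nonshortNeighbors G f d ℓ x) ≤ #(crossingPairs G f) + #(longPairs G f d ℓ) := by
  rw [← card_sigma]
  refine le_trans ?_ (card_union_le _ _)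
  refine card_le_card_of_injOn (fun e => (e.1, e.2)) ?_ ?_
  · rintro ⟨x, y⟩ he
    obtain ⟨-, hadj, hs⟩ := mem_filter.1 (mem_sigma.1 he).2
    dsimp only at hadj hs ⊢
    by_cases hc : IsAncestor f x y ∨ IsAncestor f y x
    · exact mem_union_right _ (mem_filter.2 ⟨mem_univ _, hadj, hc, hs⟩)
    · exact mem_union_left _ (mem_filter.2 ⟨mem_univ _, hadj, hc⟩)
  · rintro ⟨x, y⟩ - ⟨x', y'⟩ - he
    simpa using he

namespace IsRootedForest

/-- If few edges of `G` are crossing, then there are at most `6 * k` large sets of edges of `G` such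
that any set of edges meeting all of them closes a long cycle together with the forest. Either all
of them are the set of all long edges of `G`, or they are the sets of chords starting from the
windows of a suitable path. -/
theorem exists_hitting_family (h : IsRootedForest f d) {k q ℓ : ℕ}
    (hk : ∀ x, k ≤ #{y | G.Adj x y}) (hℓ : ℓ + 5 * q = k) (hℓ1 : 1 ≤ ℓ) (hq : 100 ≤ q)
    (hn : k ≤ Fintype.card V)
    (hC : 4000 * k ^ 3 * #(crossingPairs G f) ≤ q ^ 4 * Fintype.card V) :
    ∃ T : ℕ → Finset (Sym2 V), (∀ t, ∀ e ∈ T t, e ∈ G.edgeSet) ∧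
      (∀ t, q ^ 4 ≤ 8000 * k ^ 2 * #(T t)) ∧
      ∀ H : SimpleGraph V, (∀ v, f v ≠ v → H.Adj v (f v)) →
        (∀ t < 6 * k, ∃ e ∈ T t, e ∈ H.edgeSet) →
        ∃ (v : V) (c : H.Walk v v), c.IsCycle ∧ ℓ ≤ c.length := by
  by_cases hL : 4000 * k ^ 2 * #(longPairs G f d ℓ) ≤ q ^ 4
  · have hV : Nonempty V := Fintype.card_pos_iff.1 (by omega)
    have hN : 2000 * k ^ 3 * ∑ x, #(nonshortNeighbors G f d ℓ x) ≤ q ^ 4 * Fintype.card V := by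
      have h1 := sum_card_nonshortNeighbors_le (G := G) (f := f) (d := d) ℓ
      have h2 := Nat.mul_le_mul hL hn
      have h3 := Nat.mul_le_mul_left (4000 * k ^ 3) h1
      nlinarith
    obtain ⟨x, m, hmd, hm5, hm6, hch⟩ := h.exists_path_with_chords hk hℓ hq hN
    let P : ℕ → Finset (ℕ × ℕ) := fun t => {e ∈ range (m + 1) ×ˢ range (m + 1) |
      t ≤ e.1 + q / 4 ∧ e.1 < t ∧ e.1 + q ≤ e.2 ∧ G.Adj (f^[e.1] x) (f^[e.2] x)}
    -- Values of `t` that are not the end of a window are replaced by the end of the first window.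
    let τ : ℕ → ℕ := fun t => if q / 4 ≤ t ∧ t + k ≤ m then t else q / 4
    have hτ : ∀ t, q / 4 ≤ τ t ∧ τ t + k ≤ m := by
      intro t
      dsimp only [τ]
      split_ifs with ht
      · exact ht
      · omega
    refine ⟨fun t => ((P (τ t)).image fun e => (f^[e.1] x, f^[e.2] x)).image
      fun e => s(e.1, e.2), ?_, ?_, ?_⟩
    · intro t e he
      simp only [mem_image, exists_exists_and_eq_and] at he
      obtain ⟨a, ha, rfl⟩ := he
      exact (mem_filter.1 ha).2.2.2.2
    · intro t
      have h1 := hch (τ t) (hτ t).1 (hτ t).2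
      have h2 := card_le_two_mul_card_image_sym2 ((P (τ t)).image fun e => (f^[e.1] x, f^[e.2] x))
      rw [card_image_of_injOn (s := P (τ t))] at h2
      · have h3 : q ^ 2 ≤ k ^ 2 := Nat.pow_le_pow_left (by omega) 2
        have h4 : q ^ 2 ≤ 16 * #(((P (τ t)).image fun e => (f^[e.1] x, f^[e.2] x)).image
            fun e => s(e.1, e.2)) := by
          refine h1.trans ?_
          change 8 * #(P (τ t)) ≤ _
          omega
        calc q ^ 4 = q ^ 2 * q ^ 2 := by ring
          _ ≤ k ^ 2 * (16 * #(((P (τ t)).image fun e => (f^[e.1] x, f^[e.2] x)).image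
            fun e => s(e.1, e.2))) := Nat.mul_le_mul h3 h4
          _ ≤ _ := by
            rw [← mul_assoc]
            exact Nat.mul_le_mul_right _ (by omega)
      · intro a ha b hb hab
        have ha := mem_product.1 (mem_filter.1 ha).1
        have hb := mem_product.1 (mem_filter.1 hb).1
        simp only [mem_range] at ha hb
        simp only [Prod.mk.injEq] at hab
        exact Prod.ext (h.iterate_injOn x (by omega) (by omega) hab.1)
          (h.iterate_injOn x (by omega) (by omega) hab.2)
    · intro H hf hT
      obtain ⟨v, c, hc, hlen⟩ := exists_cycle_of_chords (H := H) (x := fun i => f^[i] x)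
        (m := m) (w := q / 4) (s := q) (M := m - k)
        (fun i j hi hj hij => h.iterate_injOn x (by omega) (by omega) hij)
        (fun i hi => h.adj_iterate hf (by omega)) (by omega) (by omega) (by omega) (by
          intro t ht1 ht2
          obtain ⟨e, he, heH⟩ := hT t (by omega)
          have hτt : τ t = t := if_pos ⟨ht1, by omega⟩
          simp only [mem_image, exists_exists_and_eq_and, hτt] at he
          obtain ⟨a, ha, rfl⟩ := he
          obtain ⟨ha1, ha2, ha3, ha4, -⟩ := mem_filter.1 ha
          have ha1 := mem_range.1 (mem_product.1 ha1).2
          exact ⟨a.1, a.2, ha2, ha3, ha4, by omega, heH⟩)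
      exact ⟨v, c, hc, by omega⟩
  · refine ⟨fun _ => (longPairs G f d ℓ).image fun e => s(e.1, e.2), ?_, ?_, ?_⟩
    · intro t e he
      obtain ⟨a, ha, rfl⟩ := mem_image.1 he
      exact (mem_filter.1 ha).2.1
    · intro t
      have h1 := card_le_two_mul_card_image_sym2 (longPairs G f d ℓ)
      have h2 := Nat.mul_le_mul_left (4000 * k ^ 2) h1
      have h3 := (not_le.1 hL).le.trans h2
      linarith
    · intro H hf hT
      obtain ⟨e, he, heH⟩ := hT 0 (by omega)
      obtain ⟨⟨x, y⟩, ha, rfl⟩ := mem_image.1 he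
      obtain ⟨-, -, hcomp, hs⟩ := mem_filter.1 ha
      dsimp only at hcomp hs heH
      rw [SimpleGraph.mem_edgeSet] at heH
      rcases hcomp with hc | hc
      · refine h.exists_cycle_of_isAncestor hf hℓ1 heH.symm hc ?_
        by_contra hlt
        exact hs (Or.inl ⟨hc, by omega⟩)
      · refine h.exists_cycle_of_isAncestor hf hℓ1 heH hc ?_
        by_contra hlt
        exact hs (Or.inr ⟨hc, by omega⟩)

end IsRootedForest

end Hitting

/-! ### Probabilities of events for Bernoulli random sets -/

section Bernoulli

open ProbabilityTheory Finset Classical unitInterval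

variable {ι : Type u}

lemma setBernoulli_subset_and_disjoint (u : Set ι) (p : I) (A B : Finset ι) (hAB : Disjoint A B) :
    setBernoulli u p {S | (∀ i ∈ A, i ∈ S) ∧ ∀ i ∈ B, i ∉ S} =
      (∏ i ∈ A, if i ∈ u then (toNNReal p : ℝ≥0∞) else 0) *
        ∏ i ∈ B, if i ∈ u then (toNNReal (σ p) : ℝ≥0∞) else 1 := by
  rw [setBernoulli_apply']
  have h1 : ((fun P : ι → Prop => {i | P i}) ⁻¹' {S | (∀ i ∈ A, i ∈ S) ∧ ∀ i ∈ B, i ∉ S}) =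
      Set.pi ((A ∪ B : Finset ι) : Set ι) (fun i => if i ∈ A then {True} else {False}) := by
    ext P
    simp only [Set.mem_preimage, Set.mem_ofPred_eq, Set.mem_pi, Finset.mem_coe, mem_union]
    constructor
    · rintro ⟨hA, hB⟩ i hi
      by_cases hiA : i ∈ A
      · simp [hiA, hA i hiA]
      · simp [hiA, hB i (hi.resolve_left hiA)]
    · intro hP
      refine ⟨fun i hi => ?_, fun i hi => ?_⟩
      · simpa [hi] using hP i (Or.inl hi)
      · have hiA : i ∉ A := fun h => Finset.disjoint_left.1 hAB h hi
        simpa [hiA] using hP i (Or.inr hi)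
  rw [h1, Measure.infinitePi_pi _ (fun i _ => by split_ifs <;> exact measurableSet_singleton _),
    prod_union hAB]
  congr 1
  · refine prod_congr rfl fun i hi => ?_
    by_cases hu : i ∈ u <;> simp [hi, hu]
  · refine prod_congr rfl fun i hi => ?_
    have hiA : i ∉ A := fun h => Finset.disjoint_left.1 hAB h hi
    have h2 : (toNNReal p : ℝ≥0∞) + (toNNReal (σ p) : ℝ≥0∞) = 1 := by
      rw [← ENNReal.coe_add]
      simp
    by_cases hu : i ∈ u <;> simp [hiA, hu, h2]

lemma setBernoulli_real_subset_and_disjoint {u : Set ι} (p : I) {A B : Finset ι}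
    (hAB : Disjoint A B) (hA : ∀ i ∈ A, i ∈ u) (hB : ∀ i ∈ B, i ∈ u) :
    (setBernoulli u p).real {S | (∀ i ∈ A, i ∈ S) ∧ ∀ i ∈ B, i ∉ S} =
      (p : ℝ) ^ #A * (1 - p : ℝ) ^ #B := by
  rw [measureReal_def, setBernoulli_subset_and_disjoint u p A B hAB,
    prod_congr rfl (fun i hi => if_pos (hA i hi)), prod_congr rfl (fun i hi => if_pos (hB i hi)),
    prod_const, prod_const]
  simp

lemma setBernoulli_disjoint (u : Set ι) (p : I) (B : Finset ι) :
    setBernoulli u p {S | ∀ i ∈ B, i ∉ S} =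
      ∏ i ∈ B, if i ∈ u then (toNNReal (σ p) : ℝ≥0∞) else 1 := by
  simpa using setBernoulli_subset_and_disjoint u p ∅ B (by simp)

/-- The union of two independent Bernoulli random sets is a Bernoulli random set. -/
lemma map_union_setBernoulli [Finite ι] (u : Set ι) {p p₁ p₂ : I}
    (hp : (1 - p₁ : ℝ) * (1 - p₂) = 1 - p) :
    ((setBernoulli u p₁).prod (setBernoulli u p₂)).map (fun S => S.1 ∪ S.2) =
      setBernoulli u p := by
  have := Fintype.ofFinite ι
  have hp' : (toNNReal (σ p₁) : ℝ≥0∞) * toNNReal (σ p₂) = toNNReal (σ p) := by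
    rw [← ENNReal.coe_mul, ENNReal.coe_inj]
    exact NNReal.coe_injective (by simpa using hp)
  have hmeas : Measurable (fun S : Set ι × Set ι => S.1 ∪ S.2) := Measurable.of_discrete
  have : IsProbabilityMeasure
      (((setBernoulli u p₁).prod (setBernoulli u p₂)).map (fun S => S.1 ∪ S.2)) :=
    Measure.isProbabilityMeasure_map hmeas.aemeasurable
  refine ext_of_generate_finite (Set.range fun B : Finset ι => {S : Set ι | ∀ i ∈ B, i ∉ S})
    ?_ ?_ ?_ (by simp)
  · refine le_antisymm ?_ (MeasurableSpace.generateFrom_le ?_)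
    · let m := MeasurableSpace.generateFrom
        (Set.range fun B : Finset ι => {S : Set ι | ∀ i ∈ B, i ∉ S})
      have h1 : @Measurable _ _ m Set.instMeasurableSpace (id : Set ι → Set ι) := by
        refine (@measurable_set_iff ι (Set ι) m id).2 fun i => ?_
        refine (@measurableSet_setOfPred _ m _).1 (@MeasurableSet.of_compl _ _ m ?_)
        refine MeasurableSpace.measurableSet_generateFrom ⟨{i}, ?_⟩
        ext S
        simp
      intro s hs
      exact h1 hs
    · rintro _ ⟨B, rfl⟩
      exact MeasurableSet.of_discrete
  · rintro _ ⟨B, rfl⟩ _ ⟨B', rfl⟩ -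
    refine ⟨B ∪ B', ?_⟩
    ext S
    simp only [mem_union, Set.mem_ofPred_eq, Set.mem_inter_iff]
    exact ⟨fun h => ⟨fun i hi => h i (Or.inl hi), fun i hi => h i (Or.inr hi)⟩,
      fun h i hi => hi.elim (h.1 i) (h.2 i)⟩
  · rintro _ ⟨B, rfl⟩
    have h1 : (fun S : Set ι × Set ι => S.1 ∪ S.2) ⁻¹' {S | ∀ i ∈ B, i ∉ S} =
        {S | ∀ i ∈ B, i ∉ S} ×ˢ {S | ∀ i ∈ B, i ∉ S} := by
      ext S
      simp only [Set.mem_preimage, Set.mem_ofPred_eq, Set.mem_union, not_or, Set.mem_prod]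
      exact ⟨fun h => ⟨fun i hi => (h i hi).1, fun i hi => (h i hi).2⟩,
        fun h i hi => ⟨h.1 i hi, h.2 i hi⟩⟩
    rw [Measure.map_apply hmeas MeasurableSet.of_discrete, h1, Measure.prod_prod,
      setBernoulli_disjoint, setBernoulli_disjoint, setBernoulli_disjoint, ← prod_mul_distrib]
    refine prod_congr rfl fun i _ => ?_
    split_ifs
    · exact hp'
    · simp

/-- Two-round exposure: if, for each outcome of the first round outside of a set `X`, the second
round fails with probability at most `b`, then the union of both rounds fails with probability at
most `P(X) + b`. -/
lemma setBernoulli_real_le_of_union [Finite ι] (u : Set ι) {p p₁ p₂ : I}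
    (hp : (1 - p₁ : ℝ) * (1 - p₂) = 1 - p) (F X : Set (Set ι)) {b : ℝ} (hb : 0 ≤ b)
    (h : ∀ S₁ ∉ X, (setBernoulli u p₂).real {S₂ | S₁ ∪ S₂ ∈ F} ≤ b) :
    (setBernoulli u p).real F ≤ (setBernoulli u p₁).real X + b := by
  have hmeas : Measurable (fun S : Set ι × Set ι => S.1 ∪ S.2) := Measurable.of_discrete
  have h1 : setBernoulli u p F ≤ setBernoulli u p₁ X + ENNReal.ofReal b := by
    rw [← map_union_setBernoulli u hp, Measure.map_apply hmeas MeasurableSet.of_discrete,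
      Measure.prod_apply MeasurableSet.of_discrete]
    calc _ ≤ ∫⁻ S₁, (X.indicator 1 S₁ + ENNReal.ofReal b) ∂setBernoulli u p₁ := by
          refine lintegral_mono fun S₁ => ?_
          by_cases hS : S₁ ∈ X
          · rw [Set.indicator_of_mem hS]
            exact prob_le_one.trans le_self_add
          · rw [Set.indicator_of_notMem hS, zero_add, ENNReal.le_ofReal_iff_toReal_le
              (measure_ne_top _ _) hb]
            exact h S₁ hS
      _ = _ := by
          rw [lintegral_add_right _ measurable_const, lintegral_indicator_one
            MeasurableSet.of_discrete, lintegral_const, measure_univ, mul_one]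
  refine ENNReal.toReal_le_of_le_ofReal (by positivity) (h1.trans ?_)
  rw [ENNReal.ofReal_add measureReal_nonneg hb, ofReal_measureReal]

/-- A Bernoulli random set misses one of `N` sets of size at least `s` only with small
probability. -/
lemma setBernoulli_real_exists_disjoint_le {u : Set ι} (p : I) (N : ℕ) {s : ℝ}
    (T : ℕ → Finset ι) (hT : ∀ t, ∀ i ∈ T t, i ∈ u) (hs : ∀ t, s ≤ #(T t)) :
    (setBernoulli u p).real {S | ∃ t < N, ∀ i ∈ T t, i ∉ S} ≤ N * Real.exp (-(p * s)) := by
  have h1 : {S : Set ι | ∃ t < N, ∀ i ∈ T t, i ∉ S} =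
      ⋃ t ∈ range N, {S | ∀ i ∈ T t, i ∉ S} := by
    ext S
    simp
  rw [h1]
  refine (measureReal_biUnion_finset_le _ _).trans ?_
  rw [← nsmul_eq_mul]
  conv_rhs => rw [← card_range N]
  refine sum_le_card_nsmul _ _ _ fun t _ => ?_
  have h2 := setBernoulli_real_subset_and_disjoint p (disjoint_empty_left (T t)) (by simp) (hT t)
  simp only [Finset.notMem_empty, false_implies, implies_true, true_and, card_empty, pow_zero,
    one_mul] at h2
  rw [h2]
  have hp0 : (0 : ℝ) ≤ p := p.2.1
  have hp1 : (0 : ℝ) ≤ 1 - p := sub_nonneg.2 p.2.2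
  calc (1 - p : ℝ) ^ #(T t) ≤ Real.exp (-p) ^ #(T t) :=
        pow_le_pow_left₀ hp1 (Real.one_sub_le_exp_neg _) _
    _ = Real.exp (-(p * #(T t))) := by
        rw [← Real.exp_nat_mul]
        congr 1
        ring
    _ ≤ _ := Real.exp_le_exp.2 (neg_le_neg (mul_le_mul_of_nonneg_left (hs t) hp0))

end Bernoulli

/-! ### First moment bound for forests with many crossing edges -/

section FirstMoment

open ProbabilityTheory Finset Classical unitInterval

variable {V : Type u} [Fintype V]

/-- Keeping `k` edges at each vertex gives a subgraph with minimum degree at least `k` and average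
degree at most `2 * k`. -/
lemma exists_sparse_subgraph (G : SimpleGraph V) {k : ℕ} (hk : ∀ x, k ≤ #{y | G.Adj x y}) :
    ∃ G' ≤ G, (∀ x, k ≤ #{y | G'.Adj x y}) ∧
      ∑ x, #{y | G'.Adj x y} ≤ 2 * k * Fintype.card V := by
  choose N hN hNk using fun x => exists_subset_card_eq (hk x)
  have hNadj : ∀ x y, y ∈ N x → G.Adj x y := fun x y h => (mem_filter.1 (hN x h)).2
  obtain ⟨G', hG'⟩ : ∃ G' : SimpleGraph V, ∀ x y, G'.Adj x y ↔ y ∈ N x ∨ x ∈ N y :=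
    ⟨{ Adj := fun x y => y ∈ N x ∨ x ∈ N y
       symm := ⟨fun x y h => h.symm⟩
       loopless := ⟨fun x h => (hNadj x x (h.elim id id)).ne rfl⟩ }, fun _ _ => Iff.rfl⟩
  refine ⟨G', fun x y h => ((hG' x y).1 h).elim (hNadj x y) fun h' => (hNadj y x h').symm,
    fun x => ?_, ?_⟩
  · rw [← hNk x]
    exact card_le_card fun y hy => mem_filter.2 ⟨mem_univ _, (hG' x y).2 (Or.inl hy)⟩
  · have h1 : ∀ x, #{y | G'.Adj x y} ≤ #(N x) + #{y | x ∈ N y} := by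
      intro x
      refine le_trans (card_le_card fun y hy => ?_) (card_union_le _ _)
      rcases (hG' x y).1 (mem_filter.1 hy).2 with h | h
      · exact mem_union_left _ h
      · exact mem_union_right _ (mem_filter.2 ⟨mem_univ _, h⟩)
    have h2 : ∑ x, #{y | x ∈ N y} = ∑ y, #(N y) := by
      have := sum_card_bipartiteAbove_eq_sum_card_bipartiteBelow (s := (univ : Finset V))
        (t := (univ : Finset V)) (fun x y => x ∈ N y)
      refine this.trans (sum_congr rfl fun y _ => congrArg card ?_)
      ext x
      simp [bipartiteBelow]
    have h3 : ∑ y, #(N y) = Fintype.card V * k := by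
      rw [sum_congr rfl fun y _ => hNk y, sum_const, smul_eq_mul, card_univ]
    calc ∑ x, #{y | G'.Adj x y} ≤ ∑ x, (#(N x) + #{y | x ∈ N y}) := sum_le_sum fun x _ => h1 x
      _ = 2 * k * Fintype.card V := by
        rw [sum_add_distrib, h2, h3]
        ring

/-- If the `a i` are at most `x` on average, then so are the `1 + a i` at most `1 + x` in the
geometric mean. -/
lemma prod_one_add_le_pow {ι : Type u} [Fintype ι] (a : ι → ℝ) (ha : ∀ i, 0 ≤ a i) {x : ℝ}
    (hx : 0 ≤ x) (hax : ∑ i, a i ≤ x * Fintype.card ι) :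
    ∏ i, (1 + a i) ≤ (1 + x) ^ Fintype.card ι := by
  have hx1 : 0 < 1 + x := by linarith
  calc ∏ i, (1 + a i) ≤ ∏ i, ((1 + x) * Real.exp ((a i - x) / (1 + x))) := by
        refine prod_le_prod (fun i _ => by linarith [ha i]) fun i _ => ?_
        have h1 := Real.add_one_le_exp ((a i - x) / (1 + x))
        calc 1 + a i = (1 + x) * ((a i - x) / (1 + x) + 1) := by field_simp; ring
          _ ≤ _ := mul_le_mul_of_nonneg_left h1 hx1.le
    _ = (1 + x) ^ Fintype.card ι * Real.exp ((∑ i, a i - x * Fintype.card ι) / (1 + x)) := by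
        rw [prod_mul_distrib, prod_const, card_univ, ← Real.exp_sum, ← sum_div, sum_sub_distrib,
          sum_const, card_univ, nsmul_eq_mul, mul_comm x]
    _ ≤ (1 + x) ^ Fintype.card ι * 1 := by
        refine mul_le_mul_of_nonneg_left ?_ (by positivity)
        rw [Real.exp_le_one_iff]
        exact div_nonpos_of_nonpos_of_nonneg (by linarith) hx1.le
    _ = _ := mul_one _

/-- The outcomes `S` for which some rooted forest with edges in `S` is normal with respect to the
edges of `G'` in `S`, although at least `s` edges of `G'` (as ordered pairs) are crossing. -/
def badForestEvent (G' : SimpleGraph V) (s : ℝ) : Set (Set (Sym2 V)) :=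
  {S | ∃ (f : V → V) (d : V → ℕ), IsRootedForest f d ∧
    (∀ v, f v ≠ v → G'.Adj v (f v) ∧ s(v, f v) ∈ S) ∧
    (∀ e ∈ crossingPairs G' f, s(e.1, e.2) ∉ S) ∧ s ≤ #(crossingPairs G' f)}

/-- For a fixed forest, its edges have to be present and its crossing edges have to be absent. The
sum over all forests of the probabilities that its edges are present is at most the product over the
vertices of `1 + p * degree`. -/
lemma setBernoulli_real_badForestEvent_le {G G' : SimpleGraph V} (hG : G' ≤ G) (p : I) {x s : ℝ}
    (hx : 0 ≤ x) (hdeg : p * ∑ v, (#{y | G'.Adj v y} : ℝ) ≤ x * Fintype.card V) :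
    (setBernoulli G.edgeSet p).real (badForestEvent G' s) ≤
      (1 + x) ^ Fintype.card V * Real.exp (-(p * s / 2)) := by
  have hp0 : (0 : ℝ) ≤ p := p.2.1
  have hp1 : (0 : ℝ) ≤ 1 - p := sub_nonneg.2 p.2.2
  let valid : Finset (V → V) := {f | (∃ d, IsRootedForest f d) ∧ (∀ v, f v ≠ v → G'.Adj v (f v)) ∧
    s ≤ #(crossingPairs G' f)}
  let A : (V → V) → Finset (Sym2 V) := fun f => ({v | f v ≠ v} : Finset V).image fun v => s(v, f v)
  let B : (V → V) → Finset (Sym2 V) := fun f => (crossingPairs G' f).image fun e => s(e.1, e.2)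
  let w : V → V → ℝ := fun v y => if y = v then 1 else if G'.Adj v y then (p : ℝ) else 0
  have hw : ∀ v y, 0 ≤ w v y := by
    intro v y
    dsimp only [w]
    split_ifs <;> first | exact zero_le_one | exact hp0 | exact le_rfl
  have hsub : badForestEvent G' s ⊆ ⋃ f ∈ valid, {S | (∀ e ∈ A f, e ∈ S) ∧ ∀ e ∈ B f, e ∉ S} := by
    rintro S ⟨f, d, hfd, h1, h2, h3⟩
    refine Set.mem_biUnion (x := f)
      (mem_filter.2 ⟨mem_univ _, ⟨d, hfd⟩, fun v hv => (h1 v hv).1, h3⟩) ⟨?_, ?_⟩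
    · intro e he
      obtain ⟨v, hv, rfl⟩ := mem_image.1 he
      exact (h1 v (mem_filter.1 hv).2).2
    · intro e he
      obtain ⟨a, ha, rfl⟩ := mem_image.1 he
      exact h2 a ha
  have hone : ∀ f ∈ valid,
      (setBernoulli G.edgeSet p).real {S | (∀ e ∈ A f, e ∈ S) ∧ ∀ e ∈ B f, e ∉ S} ≤
        (∏ v, w v (f v)) * Real.exp (-(p * s / 2)) := by
    intro f hf
    obtain ⟨⟨d, hfd⟩, hadj, hs⟩ := (mem_filter.1 hf).2
    have hinj : Set.InjOn (fun v => s(v, f v)) ({v | f v ≠ v} : Finset V) := by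
      intro v hv v' hv' he
      have hv := (mem_filter.1 hv).2
      have hv' := (mem_filter.1 hv').2
      rcases Sym2.eq_iff.1 he with ⟨h1, -⟩ | ⟨h1, h2⟩
      · exact h1
      · have h3 := hfd.succ v hv
        have h4 := hfd.succ v' hv'
        rw [h2] at h3
        rw [← h1] at h4
        omega
    have hdisj : Disjoint (A f) (B f) := by
      rw [Finset.disjoint_left]
      intro e heA heB
      obtain ⟨v, hv, rfl⟩ := mem_image.1 heA
      obtain ⟨⟨a, b⟩, hab, he⟩ := mem_image.1 heB
      have hab := (mem_filter.1 hab).2.2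
      change s(a, b) = s(v, f v) at he
      change ¬ (IsAncestor f a b ∨ IsAncestor f b a) at hab
      rcases Sym2.eq_iff.1 he with ⟨h1, h2⟩ | ⟨h1, h2⟩
      · exact hab (Or.inr ⟨1, by rw [h1, h2]; rfl⟩)
      · exact hab (Or.inl ⟨1, by rw [h1, h2]; rfl⟩)
    rw [setBernoulli_real_subset_and_disjoint p hdisj]
    · have hA : (p : ℝ) ^ #(A f) = ∏ v, w v (f v) := by
        rw [card_image_of_injOn hinj, ← prod_const, prod_filter]
        refine prod_congr rfl fun v _ => ?_
        by_cases hv : f v = v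
        · simp [w, hv]
        · simp [w, hv, hadj v hv]
      have hB : (1 - p : ℝ) ^ #(B f) ≤ Real.exp (-(p * s / 2)) := by
        have h1 : s / 2 ≤ #(B f) := by
          have := card_le_two_mul_card_image_sym2 (crossingPairs G' f)
          have h2 : (#(crossingPairs G' f) : ℝ) ≤ 2 * #(B f) := by exact_mod_cast this
          linarith
        calc (1 - p : ℝ) ^ #(B f) ≤ Real.exp (-p) ^ #(B f) :=
              pow_le_pow_left₀ hp1 (Real.one_sub_le_exp_neg _) _
          _ = Real.exp (-(p * #(B f))) := by
              rw [← Real.exp_nat_mul]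
              congr 1
              ring
          _ ≤ _ := Real.exp_le_exp.2 (by
              have := mul_le_mul_of_nonneg_left h1 hp0
              linarith)
      rw [hA]
      exact mul_le_mul_of_nonneg_left hB (prod_nonneg fun v _ => hw _ _)
    · intro e he
      obtain ⟨v, hv, rfl⟩ := mem_image.1 he
      exact hG (hadj v (mem_filter.1 hv).2)
    · intro e he
      obtain ⟨a, ha, rfl⟩ := mem_image.1 he
      exact hG (mem_filter.1 ha).2.1
  have hrow : ∀ v, ∑ y, w v y = 1 + p * #{y | G'.Adj v y} := by
    intro v
    have h1 : ∀ y, w v y = (if y = v then 1 else 0) + if G'.Adj v y then (p : ℝ) else 0 := by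
      intro y
      by_cases hy : y = v
      · simp [w, hy]
      · simp [w, hy]
    rw [sum_congr rfl fun y _ => h1 y, sum_add_distrib, sum_ite_eq' univ v, if_pos (mem_univ _),
      ← sum_filter, sum_const, nsmul_eq_mul, mul_comm]
  calc (setBernoulli G.edgeSet p).real (badForestEvent G' s)
      ≤ ∑ f ∈ valid, (setBernoulli G.edgeSet p).real
          {S | (∀ e ∈ A f, e ∈ S) ∧ ∀ e ∈ B f, e ∉ S} :=
        (measureReal_mono hsub (measure_ne_top _ _)).trans (measureReal_biUnion_finset_le _ _)
    _ ≤ ∑ f ∈ valid, (∏ v, w v (f v)) * Real.exp (-(p * s / 2)) := sum_le_sum hone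
    _ ≤ ∑ f : V → V, (∏ v, w v (f v)) * Real.exp (-(p * s / 2)) :=
        sum_le_sum_of_subset_of_nonneg (subset_univ _) fun f _ _ =>
          mul_nonneg (prod_nonneg fun v _ => hw _ _) (Real.exp_pos _).le
    _ = (∏ v, (1 + (p : ℝ) * #{y | G'.Adj v y})) * Real.exp (-(p * s / 2)) := by
        rw [← sum_mul, ← prod_congr rfl fun v _ => hrow v, prod_univ_sum, Fintype.piFinset_univ]
    _ ≤ _ := by
        refine mul_le_mul_of_nonneg_right ?_ (Real.exp_pos _).le
        refine prod_one_add_le_pow _ (fun v => by positivity) hx ?_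
        rwa [← mul_sum]

end FirstMoment

/-! ### Long cycles in random subgraphs -/

section RandomSubgraph

open ProbabilityTheory Finset Classical unitInterval

/-- The quantitative form of the main result for a single graph. -/
lemma setBernoulli_real_not_hasCycle_le {V : Type u} [Fintype V] (G : SimpleGraph V) {k : ℕ}
    (hk : ∀ x, k ≤ #{y | G.Adj x y}) (hkV : k ≤ Fintype.card V) (p : I) {c ε : ℝ} (hc : 0 < c)
    (hp : (p : ℝ) = c / k) (hε : 0 < ε) (hε1 : ε ≤ 1 / 10) (hεk : 101 ≤ ε * k)
    (hcε : Real.log (1 + c) + 1 ≤ c * ε ^ 4 / 256000) :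
    (setBernoulli G.edgeSet p).real
        {S | ¬ HasCycleOfLengthAtLeast (SimpleGraph.fromEdgeSet S) ((1 - 5 * ε) * k)} ≤
      Real.exp (-k) + 6 * k * Real.exp (-(c * ε ^ 4 / 256000 * k)) := by
  have hk0 : (0 : ℝ) < k := by
    by_contra h
    have : ε * k ≤ 0 := mul_nonpos_of_nonneg_of_nonpos hε.le (not_lt.1 h)
    linarith
  have hp0 : (0 : ℝ) ≤ p := p.2.1
  have hp1 : (p : ℝ) ≤ 1 := p.2.2
  -- Both rounds have edge probability at least `p / 2`.
  obtain ⟨p₁, hp₁⟩ : ∃ p₁ : I, (p₁ : ℝ) = p / 2 := ⟨⟨p / 2, by linarith, by linarith⟩, rfl⟩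
  have hden : (0 : ℝ) < 1 - p / 2 := by linarith
  obtain ⟨p₂, hp₂⟩ : ∃ p₂ : I, (p₂ : ℝ) = p / 2 / (1 - p / 2) :=
    ⟨⟨p / 2 / (1 - p / 2), by positivity, by rw [div_le_one hden]; linarith⟩, rfl⟩
  have hp12 : (1 - p₁ : ℝ) * (1 - p₂) = 1 - p := by
    have h1 : (p₂ : ℝ) * (1 - p / 2) = p / 2 := by rw [hp₂, div_mul_cancel₀ _ hden.ne']
    rw [hp₁]
    linear_combination -h1
  have hp₂' : c / (2 * k) ≤ p₂ := by
    rw [hp₂]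
    calc c / (2 * k) = p / 2 := by rw [hp]; field_simp
      _ ≤ _ := by
        rw [le_div_iff₀ hden]
        nlinarith
  obtain ⟨G', hG, hk', hsum⟩ := exists_sparse_subgraph G hk
  set n := Fintype.card V with hn
  have hkn : (k : ℝ) ≤ n := by exact_mod_cast hkV
  set q := ⌊ε * k⌋₊ with hq
  have hq1 : (q : ℝ) ≤ ε * k := Nat.floor_le (by positivity)
  have hq2 : ε * k < q + 1 := Nat.lt_floor_add_one _
  have hq100 : 100 ≤ q := by
    have : (100 : ℝ) ≤ q := by linarith
    exact_mod_cast this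
  have hqhalf : ε * k / 2 ≤ q := by linarith
  have hqk : 10 * q ≤ k := by
    have : (10 * q : ℝ) ≤ k := by nlinarith
    exact_mod_cast this
  obtain ⟨ℓ, hℓ⟩ := Nat.exists_eq_add_of_le (show 5 * q ≤ k by omega)
  have hℓr : (1 - 5 * ε) * k ≤ ℓ := by
    have : (k : ℝ) = 5 * q + ℓ := by exact_mod_cast hℓ
    nlinarith
  have hq4 : ε ^ 4 * k ^ 4 / 16 ≤ (q : ℝ) ^ 4 := by
    calc ε ^ 4 * k ^ 4 / 16 = (ε * k / 2) ^ 4 := by ring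
      _ ≤ _ := pow_le_pow_left₀ (by positivity) hqhalf 4
  refine (setBernoulli_real_le_of_union G.edgeSet hp12 _
    (badForestEvent G' (ε ^ 4 * k * n / 64000)) (by positivity) ?_).trans (add_le_add ?_ le_rfl)
  · intro S₁ hS₁
    obtain ⟨f, d, hfd, hadj, hnormal⟩ := exists_normal_forest (G' ⊓ SimpleGraph.fromEdgeSet S₁)
    have hC : (#(crossingPairs G' f) : ℝ) < ε ^ 4 * k * n / 64000 := by
      by_contra hlt
      refine hS₁ ⟨f, d, hfd, fun v hv => ⟨(hadj v hv).1, (hadj v hv).2.1⟩, fun e he heS => ?_,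
        not_lt.1 hlt⟩
      obtain ⟨-, h1, h2⟩ := mem_filter.1 he
      exact h2 (hnormal e.1 e.2 ⟨h1, heS, h1.ne⟩)
    have hC' : 4000 * k ^ 3 * #(crossingPairs G' f) ≤ q ^ 4 * n := by
      have : (4000 * k ^ 3 * #(crossingPairs G' f) : ℝ) ≤ q ^ 4 * n := by
        calc (4000 * k ^ 3 * #(crossingPairs G' f) : ℝ)
            ≤ 4000 * k ^ 3 * (ε ^ 4 * k * n / 64000) :=
              mul_le_mul_of_nonneg_left hC.le (by positivity)
          _ = ε ^ 4 * k ^ 4 / 16 * n := by ring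
          _ ≤ _ := mul_le_mul_of_nonneg_right hq4 (by positivity)
      exact_mod_cast this
    obtain ⟨T, hT1, hT2, hT3⟩ := hfd.exists_hitting_family hk' (by omega : ℓ + 5 * q = k)
      (by omega) hq100 hkV hC'
    have hsize : ∀ t, ε ^ 4 * k ^ 2 / 128000 ≤ (#(T t) : ℝ) := by
      intro t
      have h1 : (q : ℝ) ^ 4 ≤ 8000 * k ^ 2 * #(T t) := by exact_mod_cast hT2 t
      refine le_of_mul_le_mul_left ?_ (by positivity : (0 : ℝ) < 8000 * k ^ 2)
      calc (8000 * k ^ 2 : ℝ) * (ε ^ 4 * k ^ 2 / 128000) = ε ^ 4 * k ^ 4 / 16 := by ring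
        _ ≤ _ := hq4.trans h1
    have hmiss := setBernoulli_real_exists_disjoint_le p₂ (6 * k) T
      (fun t e he => SimpleGraph.edgeSet_mono hG (hT1 t e he)) hsize
    refine (measureReal_mono ?_).trans (hmiss.trans ?_)
    · intro S₂ hS₂
      by_contra hall
      simp only [Set.mem_ofPred_eq, not_exists, not_and, not_forall, not_not] at hall
      refine hS₂ ?_
      obtain ⟨v, cyc, hcyc, hlen⟩ := hT3 (SimpleGraph.fromEdgeSet (S₁ ∪ S₂))
        (fun v hv => ⟨Or.inl (hadj v hv).2.1, (hadj v hv).1.ne⟩) (by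
          intro t ht
          obtain ⟨e, he, heS⟩ := hall t ht
          refine ⟨e, he, ?_⟩
          rw [SimpleGraph.edgeSet_fromEdgeSet]
          exact ⟨Or.inr heS, SimpleGraph.not_isDiag_of_mem_edgeSet _ (hT1 t e he)⟩)
      exact ⟨v, cyc, hcyc, hℓr.trans (by exact_mod_cast hlen)⟩
    · push_cast
      refine mul_le_mul_of_nonneg_left (Real.exp_le_exp.2 (neg_le_neg ?_)) (by positivity)
      calc c * ε ^ 4 / 256000 * k = c / (2 * k) * (ε ^ 4 * k ^ 2 / 128000) := by
            field_simp
            norm_num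
        _ ≤ _ := mul_le_mul_of_nonneg_right hp₂' (by positivity)
  · have hdeg : (p₁ : ℝ) * ∑ v, (#{y | G'.Adj v y} : ℝ) ≤ c * n := by
      have h1 : (∑ v, (#{y | G'.Adj v y} : ℝ)) ≤ 2 * k * n := by exact_mod_cast hsum
      calc (p₁ : ℝ) * ∑ v, (#{y | G'.Adj v y} : ℝ) ≤ p₁ * (2 * k * n) :=
            mul_le_mul_of_nonneg_left h1 p₁.2.1
        _ = c * n := by
            rw [hp₁, hp]
            field_simp
    refine (setBernoulli_real_badForestEvent_le hG p₁ hc.le hdeg).trans ?_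
    have h1 : (1 + c) ^ n = Real.exp (n * Real.log (1 + c)) := by
      rw [Real.exp_nat_mul, Real.exp_log (by linarith)]
    have h2 : (p₁ : ℝ) * (ε ^ 4 * k * n / 64000) / 2 = n * (c * ε ^ 4 / 256000) := by
      rw [hp₁, hp]
      field_simp
      ring
    rw [h1, ← Real.exp_add, h2]
    refine Real.exp_le_exp.2 ?_
    have h3 := mul_le_mul_of_nonneg_left hcε (by positivity : (0 : ℝ) ≤ n)
    linarith

/-- If `c * ε ^ 4` is large compared to `log c`, then there is a.a.s. a cycle of length at least
`(1 - 5 * ε) * k`. -/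
theorem aasHasCycle_of_log_le {c ε : ℝ} (hc : 0 < c) (hε : 0 < ε) (hε1 : ε ≤ 1 / 10)
    (hcε : Real.log (1 + c) + 1 ≤ c * ε ^ 4 / 256000) (S : MinDegreeSequence.{u}) :
    AASHasCycle S c (1 - 5 * ε) := by
  set a := c * ε ^ 4 / 256000 with ha
  have ha0 : 0 < a := by positivity
  have herr : Tendsto (fun k : ℕ => ENNReal.ofReal
      (1 - (Real.exp (-k) + 6 * k * Real.exp (-(a * k))))) atTop (𝓝 1) := by
    have h1 : Tendsto (fun k : ℕ => Real.exp (-(k : ℝ))) atTop (𝓝 0) :=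
      Real.tendsto_exp_neg_atTop_nhds_zero.comp tendsto_natCast_atTop_atTop
    have h2 : Tendsto (fun x : ℝ => x * Real.exp (-(a * x))) atTop (𝓝 0) := by
      have := Real.tendsto_pow_mul_exp_neg_atTop_nhds_zero 1
      have h3 := (this.comp (tendsto_id.const_mul_atTop ha0)).const_mul (1 / a)
      rw [mul_zero] at h3
      refine h3.congr fun x => ?_
      simp only [Function.comp, id, pow_one]
      field_simp
    have h4 := (h2.comp tendsto_natCast_atTop_atTop).const_mul 6
    have h5 := (tendsto_const_nhds (x := (1 : ℝ))).sub (h1.add h4)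
    have h6 := ENNReal.tendsto_ofReal h5
    simp only [mul_zero, add_zero, sub_zero, ENNReal.ofReal_one] at h6
    refine h6.congr fun k => ?_
    simp only [Function.comp]
    congr 3
    ring
  refine tendsto_of_tendsto_of_tendsto_of_le_of_le' herr tendsto_const_nhds ?_ ?_
  · filter_upwards [eventually_ge_atTop 1, eventually_ge_atTop ⌈c⌉₊,
      eventually_ge_atTop ⌈101 / ε⌉₊] with k hk1 hkc hkε
    have hk0 : (0 : ℝ) < k := by exact_mod_cast hk1
    have hkc' : c ≤ k := Nat.ceil_le.1 hkc
    have hkε' : 101 ≤ ε * k := by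
      have := Nat.ceil_le.1 hkε
      rw [div_le_iff₀ hε] at this
      linarith
    let := S.fintypeV k
    have hdeg : ∀ x, k ≤ #{y | (S.G k).Adj x y} := by
      intro x
      refine (S.le_minDegree k hk1).trans (((S.G k).minDegree_le_degree x).trans (le_of_eq ?_))
      rw [← SimpleGraph.card_neighborFinset_eq_degree]
      congr 1
      ext y
      simp
    have hcard : k ≤ Fintype.card (S.V k) := by
      have hV : Nonempty (S.V k) := by
        by_contra hV
        rw [not_nonempty_iff] at hV
        have h1 := S.le_minDegree k hk1
        rw [SimpleGraph.minDegree_of_subsingleton] at h1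
        omega
      obtain ⟨x⟩ := hV
      exact (hdeg x).trans (card_le_univ _)
    have hp : (toProb (c / k) : ℝ) = c / k := by
      have h1 : c / k ∈ Set.Icc (0 : ℝ) 1 :=
        ⟨by positivity, (div_le_one hk0).2 hkc'⟩
      rw [toProb, Set.projIcc_of_mem zero_le_one h1]
    have hmain := setBernoulli_real_not_hasCycle_le (S.G k) hdeg hcard (toProb (c / k)) hc hp hε
      hε1 hkε' hcε
    have hmeas : Measurable (SimpleGraph.fromEdgeSet : Set (Sym2 (S.V k)) → SimpleGraph (S.V k)) :=
      SimpleGraph.measurable_fromEdgeSet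
    refine le_trans ?_ (Measure.le_map_apply hmeas.aemeasurable _)
    rw [← ofReal_measureReal]
    refine ENNReal.ofReal_le_ofReal ?_
    have hcompl := probReal_compl_eq_one_sub (μ := setBernoulli (S.G k).edgeSet (toProb (c / k)))
      (MeasurableSet.of_discrete (s := {T : Set (Sym2 (S.V k)) |
        ¬ HasCycleOfLengthAtLeast (SimpleGraph.fromEdgeSet T) ((1 - 5 * ε) * k)}))
    have hset : SimpleGraph.fromEdgeSet ⁻¹' {H | HasCycleOfLengthAtLeast H ((1 - 5 * ε) * k)} =
        {T : Set (Sym2 (S.V k)) |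
        ¬ HasCycleOfLengthAtLeast (SimpleGraph.fromEdgeSet T) ((1 - 5 * ε) * k)}ᶜ := by
      ext T
      simp
    rw [hset, hcompl]
    linarith
  · refine Eventually.of_forall fun k => ?_
    let := S.fintypeV k
    have : IsProbabilityMeasure (randomSubgraph (S.G k) (toProb (c / k))) :=
      Measure.isProbabilityMeasure_map SimpleGraph.measurable_fromEdgeSet.aemeasurable
    exact prob_le_one

/-- The complete graphs show that no constant larger than `1` is possible. -/
lemma betaPrime_le_one (c : ℝ) : betaPrime.{u} c ≤ 1 := by
  let S : MinDegreeSequence.{u} :=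
    { V := fun k => ULift.{u} (Fin (k + 1))
      G := fun k => ⊤
      le_minDegree := fun k _ => by
        have h : k ≤ (⊤ : SimpleGraph (ULift.{u} (Fin (k + 1)))).minDegree :=
          SimpleGraph.le_minDegree_of_forall_le_degree _ _ fun v => by simp
        convert h }
  refine (iInf_le _ S).trans (iSup₂_le fun α hα => ?_)
  by_contra hlt
  have hα1 : (1 : ℝ) < α := by
    have := not_le.1 hlt
    exact_mod_cast this
  have hzero : ∀ᶠ k : ℕ in atTop, randomSubgraph (S.G k) (toProb (c / k))
      {H | HasCycleOfLengthAtLeast H (α * k)} = 0 := by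
    filter_upwards [eventually_gt_atTop ⌈1 / ((α : ℝ) - 1)⌉₊] with k hk
    have hk' : (1 : ℝ) < (α - 1) * k := by
      have h1 := (Nat.le_ceil (1 / ((α : ℝ) - 1))).trans_lt (Nat.cast_lt.2 hk)
      rw [div_lt_iff₀ (by linarith)] at h1
      linarith
    convert measure_empty (μ := randomSubgraph (S.G k) (toProb (c / k)))
    rw [Set.eq_empty_iff_forall_notMem]
    rintro H ⟨v, w, hw, hlen⟩
    have h1 : w.length ≤ k + 1 := by
      have h2 := hw.support_nodup.length_le_card
      simpa [S] using h2
    have h3 : (w.length : ℝ) ≤ k + 1 := by exact_mod_cast h1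
    linarith
  have h0 := tendsto_nhds_unique (hα.congr' hzero) tendsto_const_nhds
  exact one_ne_zero h0

lemma eventually_log_le :
    ∀ᶠ c : ℝ in atTop,
      Real.log (1 + c) + 1 ≤ c * (c ^ (-(1 / 5) : ℝ)) ^ 4 / 256000 := by
  have h1 : (fun c : ℝ => Real.log (1 + c) + 1) =o[atTop] fun c : ℝ => c ^ (1 / 5 : ℝ) := by
    have h2 : (fun c : ℝ => Real.log c) =o[atTop] fun c : ℝ => c ^ (1 / 5 : ℝ) :=
      isLittleO_log_rpow_atTop (by norm_num)
    have h3 : (fun _ : ℝ => (1 + Real.log 2 : ℝ)) =o[atTop] fun c : ℝ => c ^ (1 / 5 : ℝ) :=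
      Asymptotics.isLittleO_const_left.2
        (Or.inr (tendsto_norm_atTop_atTop.comp (tendsto_rpow_atTop (by norm_num))))
    refine Asymptotics.IsBigO.trans_isLittleO ?_ (h2.add h3)
    refine Asymptotics.IsBigO.of_bound 1 ?_
    filter_upwards [eventually_ge_atTop 1] with c hc
    have h4 : Real.log (1 + c) ≤ Real.log 2 + Real.log c := by
      rw [← Real.log_mul (by norm_num) (by linarith)]
      exact Real.log_le_log (by linarith) (by linarith)
    have h5 : 0 ≤ Real.log (1 + c) := Real.log_nonneg (by linarith)
    rw [one_mul, Real.norm_of_nonneg (by linarith)]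
    exact le_trans (by linarith) (le_abs_self _)
  filter_upwards [h1.bound (show (0 : ℝ) < 1 / 256000 by norm_num), eventually_gt_atTop 0]
    with c hc hc0
  have h6 : c * (c ^ (-(1 / 5) : ℝ)) ^ 4 = c ^ (1 / 5 : ℝ) := by
    rw [← Real.rpow_natCast, ← Real.rpow_mul hc0.le]
    nth_rewrite 1 [← Real.rpow_one c]
    rw [← Real.rpow_add hc0]
    norm_num
  rw [h6]
  have h7 := (le_abs_self _).trans hc
  rw [Real.norm_of_nonneg (by positivity)] at h7
  linarith

end RandomSubgraph

theorem theorem3 :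
    ((∀ᶠ c : ℝ in atTop, betaPrime.{u} c ≠ ⊤) ∧
      (fun c : ℝ => 1 - (betaPrime.{u} c).toReal) =O[atTop] fun c : ℝ => c ^ (-(1 / 5) : ℝ)) ∧
    ∃ C c₀ : ℝ, 0 < C ∧ 0 < c₀ ∧ ∀ c : ℝ, c₀ ≤ c → ∀ S : MinDegreeSequence.{u},
      AASHasCycle S c (1 - C * c ^ (-(1 / 5) : ℝ)) := by
  have hsmall : ∀ᶠ c : ℝ in atTop, c ^ (-(1 / 5) : ℝ) ≤ 1 / 10 :=
    (tendsto_rpow_neg_atTop (by norm_num : (0 : ℝ) < 1 / 5)).eventually_le_const (by norm_num)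
  have hmain : ∀ᶠ c : ℝ in atTop, 0 < c ∧ c ^ (-(1 / 5) : ℝ) ≤ 1 / 10 ∧
      ∀ S : MinDegreeSequence.{u}, AASHasCycle S c (1 - 5 * c ^ (-(1 / 5) : ℝ)) := by
    filter_upwards [hsmall, eventually_log_le, eventually_gt_atTop 0] with c h1 h2 h3
    exact ⟨h3, h1, aasHasCycle_of_log_le h3 (Real.rpow_pos_of_pos h3 _) h1 h2⟩
  have htop : ∀ c, betaPrime.{u} c ≠ ⊤ := fun c =>
    ne_top_of_le_ne_top ENNReal.one_ne_top (betaPrime_le_one c)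
  refine ⟨⟨Eventually.of_forall htop, Asymptotics.IsBigO.of_bound 5 ?_⟩, ?_⟩
  · filter_upwards [hmain] with c ⟨hc0, hc1, hS⟩
    have hpos := Real.rpow_pos_of_pos hc0 (-(1 / 5) : ℝ)
    have hle : (betaPrime.{u} c).toReal ≤ 1 := by
      simpa using ENNReal.toReal_mono ENNReal.one_ne_top (betaPrime_le_one.{u} c)
    have hge : ENNReal.ofReal (1 - 5 * c ^ (-(1 / 5) : ℝ)) ≤ betaPrime.{u} c := by
      refine le_iInf fun S => ?_
      refine le_iSup₂_of_le (Real.toNNReal (1 - 5 * c ^ (-(1 / 5) : ℝ))) ?_ le_rfl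
      rw [Real.coe_toNNReal _ (by linarith)]
      exact hS S
    have hge' := (ENNReal.ofReal_le_iff_le_toReal (htop c)).1 hge
    rw [Real.norm_of_nonneg (by linarith), Real.norm_of_nonneg hpos.le]
    linarith
  · obtain ⟨c₀, hc₀⟩ := eventually_atTop.1 hmain
    exact ⟨5, max c₀ 1, by norm_num, by positivity, fun c hc S =>
      (hc₀ c ((le_max_left _ _).trans hc)).2.2 S⟩
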